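/- Conventions. A tree is a nonempty finite connected acyclic (simple) graph. A subtree $S\hookrightarrow T$ is the full subgraph on a set of vertices that induces a connected (nonempty) graph. A quotient tree $q:S\twoheadrightarrow R$ is a surjection $V(S)\to V(R)$ whose fibers are vertex sets of subtrees of $S$, where two distinct vertices of $R$ are adjacent exactly when some edge of $S$ joins their fibers (so $R$ is obtained from $S$ by contracting edges). For a tree $T$ and $\alpha\in V(T)$ let $\mathcal L_T(\alpha)=\mathbb R^{V(T)\setminus\{\alpha\}}$ with coordinates $x_\gamma(\alpha)$. The arboreal singularity $\mathcal L_T$ is the quotient of $\coprod_{\alpha\in V(T)}\mathcal L_T(\alpha)$, with the quotient topology, by the equivalence relation generated by the following identifications, one for each edge $\{\alpha,\beta\}$ of $T$: $\{x_\gamma(\alpha)\}\sim\{x_\gamma(\beta)\}$ whenever $x_\beta(\alpha)=x_\alpha(\beta)\ge 0$ and $x_\gamma(\alpha)=x_\gamma(\beta)$ for all $\gamma\neq\alpha,\beta$. The central point $0\in\mathcal L_T$ is the common image of the origins of the $\mathcal L_T(\alpha)$. Let $\mathfrak P_T$ be the set of correspondences $\mathfrak p=(R\twoheadleftarrow S\hookrightarrow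 T)$, with $S\hookrightarrow T$ a subtree and $S\twoheadrightarrow R$ a quotient tree, up to isomorphism. For $\mathfrak q=(P\twoheadleftarrow Q\hookrightarrow R)$ put $\mathfrak q\circ\mathfrak p=(P\twoheadleftarrow Q\times_R S\hookrightarrow T)$. Order $\mathfrak P_T$ by $\mathfrak p\ge\mathfrak p'$ if $\mathfrak p=\mathfrak q\circ\mathfrak p'$ for some correspondence $\mathfrak q=(R\twoheadleftarrow Q\hookrightarrow R')$, where $\mathfrak p'=(R'\twoheadleftarrow S'\hookrightarrow T)$; this is a partial order. Put $\mathfrak P_T(\ge\mathfrak p)=\{\mathfrak q\in\mathfrak P_T : \mathfrak q\ge\mathfrak p\}$. A point $x\in\mathcal L_T$ leads to the correspondence $(R\twoheadleftarrow S\hookrightarrow T)$ in which $V(S)=\{\alpha : x\in\mathcal L_T(\alpha)\}$ and $R$ is obtained from $S$ by contracting the edges $\{\alpha,\beta\}$ of $S$ with $x_\beta(\alpha)=x_\alpha(\beta)>0$ at $x$. Let $\mathcal L_T(\mathfrak p)\subset\mathcal L_T$ be the subspace of points leading to $\mathfrak p$, and let $\mathcal L_T(\ge\mathfrak p)=\bigcup_{\mathfrak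 q\ge\mathfrak p}\mathcal L_T(\mathfrak q)$. Statement. Let $T$ be a tree and let $\mathfrak p=(R\twoheadleftarrow S\hookrightarrow T)\in\mathfrak P_T$. Then $\mathcal L_T(\ge\mathfrak p)$ is open in $\mathcal L_T$, the map $\mathfrak q\mapsto\mathfrak q\circ\mathfrak p$ is an isomorphism of posets $\mathfrak P_R\cong\mathfrak P_T(\ge\mathfrak p)$, and there is a homeomorphism $$\Psi:\ \mathcal L_T(\mathfrak p)\times\mathcal L_R\ \xrightarrow{\ \sim\ }\ \mathcal L_T(\ge\mathfrak p)$$ compatible with it, i.e. $\Psi\bigl(\mathcal L_T(\mathfrak p)\times\mathcal L_R(\mathfrak q)\bigr)=\mathcal L_T(\mathfrak q\circ\mathfrak p)$ for every $\mathfrak q\in\mathfrak P_R$, and such that $\Psi(x,0)=x$ for all $x\in\mathcal L_T(\mathfrak p)$. Thus the normal slice to the stratum $\mathcal L_T(\mathfrak p)$ is the arboreal singularity $\mathcal L_R$. -/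

import Mathlib

open Topology

universe u

namespace Arboreal

/-! ### The arboreal singularity of a tree -/

/-- The Euclidean space `L_T(α) = ℝ^(V(T) ∖ {α})`. Only its topology is used, so it is modelled
by plain tuples of real numbers with the product topology. -/
abbrev Chart {V : Type u} (α : V) : Type u := {γ : V // γ ≠ α} → ℝ

/-- The edge gluings: a point `a` of `L_T(α)` and a point `b` of `L_T(β)`, with `{α, β}` an edge,
are identified if `x_β(α) = x_α(β) ≥ 0` and `x_γ(α) = x_γ(β)` for all `γ ≠ α, β`. -/
def Glue {V : Type u} (T : SimpleGraph V) (a b : Σ α : V, Chart α) : Prop :=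
  ∃ h : T.Adj a.1 b.1,
    a.2 ⟨b.1, h.ne'⟩ = b.2 ⟨a.1, h.ne⟩ ∧ 0 ≤ a.2 ⟨b.1, h.ne'⟩ ∧
      ∀ (γ : V) (ha : γ ≠ a.1) (hb : γ ≠ b.1), a.2 ⟨γ, ha⟩ = b.2 ⟨γ, hb⟩

/-- The arboreal singularity `L_T`: the disjoint union of the spaces `L_T(α)`, modulo the
equivalence relation generated by the edge gluings. -/
def Singularity {V : Type u} (T : SimpleGraph V) : Type u := Quot (Glue T)

/-- The quotient topology. -/
instance {V : Type u} (T : SimpleGraph V) : TopologicalSpace (Singularity T) :=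
  inferInstanceAs (TopologicalSpace (Quot (Glue T)))

/-- The map `L_T(α) → L_T`. -/
def chart {V : Type u} (T : SimpleGraph V) (α : V) (u : Chart α) : Singularity T :=
  Quot.mk (Glue T) ⟨α, u⟩

/-! ### Correspondences of trees -/

/-- A correspondence `R ↞ S ↪ T`: a subtree `S` of `T` (a set of vertices inducing a connected
graph) and a quotient map `d : S ↠ R` (a surjection on vertices whose fibers are subtrees, the
edges of `R` being those induced by the edges of `S` between distinct fibers).
When `T` is a finite tree, `S` and `R` are automatically finite trees. -/
structure Correspondence {W V : Type u} (R : SimpleGraph W) (T : SimpleGraph V) where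
  S : Set V
  connected : (T.induce S).Connected
  d : S → W
  surjective : Function.Surjective d
  fiber_connected : ∀ r : W, (T.induce {v | ∃ h : v ∈ S, d ⟨v, h⟩ = r}).Connected
  adj_iff : ∀ r r' : W, R.Adj r r' ↔ r ≠ r' ∧ ∃ a b : S, d a = r ∧ d b = r' ∧ T.Adj a b

namespace Correspondence

/-- The preimage in `S` of a connected set of vertices of `R` is connected. -/
theorem preimage_connected {W V : Type u} {R : SimpleGraph W} {T : SimpleGraph V}
    (p : Correspondence R T) (A : Set W) (hA : (R.induce A).Connected) :
    (T.induce {v | ∃ h : v ∈ p.S, p.d ⟨v, h⟩ ∈ A}).Connected := by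
  set B : Set V := {v | ∃ h : v ∈ p.S, p.d ⟨v, h⟩ ∈ A} with hB
  have same : ∀ v v' : B, p.d ⟨v, v.2.1⟩ = p.d ⟨v', v'.2.1⟩ → (T.induce B).Reachable v v' := by
    intro v v' h
    have hsub : {x | ∃ h : x ∈ p.S, p.d ⟨x, h⟩ = p.d ⟨v, v.2.1⟩} ⊆ B := by
      rintro x ⟨hx, hx'⟩
      exact ⟨hx, by rw [hx']; exact v.2.2⟩
    have := (p.fiber_connected (p.d ⟨v, v.2.1⟩)).preconnected
      ⟨v, v.2.1, rfl⟩ ⟨v', v'.2.1, h.symm⟩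
    exact this.map (SimpleGraph.induceHomOfLE T hsub).toHom
  have key : ∀ w w' : A, (R.induce A).Reachable w w' → ∀ v v' : B,
      p.d ⟨v, v.2.1⟩ = w → p.d ⟨v', v'.2.1⟩ = w' → (T.induce B).Reachable v v' := by
    rintro w w' ⟨walk⟩
    induction walk with
    | nil =>
      intro v v' h h'
      exact same v v' (h.trans h'.symm)
    | cons hadj _ ih =>
      intro v v' h h'
      obtain ⟨-, a, b, ha, hb, hab⟩ := (p.adj_iff _ _).1 hadj
      have haB : (a : V) ∈ B := ⟨a.2, by rw [show (⟨a, a.2⟩ : p.S) = a from rfl, ha]; exact Subtype.coe_prop _⟩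
      have hbB : (b : V) ∈ B := ⟨b.2, by rw [show (⟨b, b.2⟩ : p.S) = b from rfl, hb]; exact Subtype.coe_prop _⟩
      have h1 : (T.induce B).Reachable v ⟨a, haB⟩ := same _ _ (h.trans ha.symm)
      have h2 : (T.induce B).Adj ⟨a, haB⟩ ⟨b, hbB⟩ := hab
      exact (h1.trans h2.reachable).trans (ih ⟨b, hbB⟩ v' hb h')
  obtain ⟨⟨w, hw⟩⟩ := hA.nonempty
  obtain ⟨s, hs⟩ := p.surjective w
  have : Nonempty B := ⟨⟨s, s.2, by rw [show (⟨s, s.2⟩ : p.S) = s from rfl, hs]; exact hw⟩⟩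
  exact ⟨fun v v' => key ⟨_, v.2.2⟩ ⟨_, v'.2.2⟩ (hA.preconnected _ _) v v' rfl rfl⟩

/-- The composed correspondence `q ∘ p = (P ↞ Q ×_R S ↪ T)` of `q = (P ↞ Q ↪ R)` and
`p = (R ↞ S ↪ T)`; the fiber product `Q ×_R S` is the set of vertices of `S` sent to `Q`. -/
def comp {U W V : Type u} {P : SimpleGraph U} {R : SimpleGraph W} {T : SimpleGraph V}
    (q : Correspondence P R) (p : Correspondence R T) : Correspondence P T where
  S := {v | ∃ h : v ∈ p.S, p.d ⟨v, h⟩ ∈ q.S}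
  connected := p.preimage_connected q.S q.connected
  d := fun v => q.d ⟨p.d ⟨v, v.2.1⟩, v.2.2⟩
  surjective := by
    intro r
    obtain ⟨w, rfl⟩ := q.surjective r
    obtain ⟨s, hs⟩ := p.surjective w
    refine ⟨⟨s, s.2, ?_⟩, ?_⟩
    · rw [show (⟨s, s.2⟩ : p.S) = s from rfl, hs]; exact w.2
    · exact congrArg q.d (Subtype.ext hs)
  fiber_connected := by
    intro r
    have h := p.preimage_connected _ (q.fiber_connected r)
    refine Eq.subst (motive := fun A : Set V => (T.induce A).Connected) ?_ h
    ext v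
    constructor
    · rintro ⟨h1, h2, h3⟩
      exact ⟨⟨h1, h2⟩, h3⟩
    · rintro ⟨⟨h1, h2⟩, h3⟩
      exact ⟨h1, h2, h3⟩
  adj_iff := by
    intro r r'
    rw [q.adj_iff]
    constructor
    · rintro ⟨hne, w, w', rfl, rfl, hadj⟩
      obtain ⟨-, a, b, ha, hb, hab⟩ := (p.adj_iff _ _).1 hadj
      refine ⟨hne, ⟨a, a.2, ?_⟩, ⟨b, b.2, ?_⟩, ?_, ?_, hab⟩
      · rw [show (⟨a, a.2⟩ : p.S) = a from rfl, ha]; exact w.2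
      · rw [show (⟨b, b.2⟩ : p.S) = b from rfl, hb]; exact w'.2
      · exact congrArg q.d (Subtype.ext ha)
      · exact congrArg q.d (Subtype.ext hb)
    · rintro ⟨hne, a, b, rfl, rfl, hab⟩
      refine ⟨hne, _, _, rfl, rfl, (p.adj_iff _ _).2 ⟨?_, ⟨a, a.2.1⟩, ⟨b, b.2.1⟩, rfl, rfl, hab⟩⟩
      intro h
      exact hne (congrArg q.d (Subtype.ext h))

/-- The correspondence `(R ↞ T ↪ T)` given by an isomorphism `T ≃ R`. -/
def ofIso {W V : Type u} {R : SimpleGraph W} {T : SimpleGraph V} (hT : T.Connected)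
    (e : T ≃g R) : Correspondence R T where
  S := Set.univ
  connected := by
    rw [(SimpleGraph.induceUnivIso T).connected_iff]
    exact hT
  d := fun v => e v
  surjective := fun r => ⟨⟨e.symm r, trivial⟩, e.apply_symm_apply r⟩
  fiber_connected := by
    intro r
    refine Eq.subst (motive := fun A : Set V => (T.induce A).Connected) (a := {e.symm r}) ?_ ?_
    · ext v
      constructor
      · intro h
        rw [Set.mem_singleton_iff.1 h]
        exact ⟨trivial, e.apply_symm_apply r⟩
      · rintro ⟨_, hv⟩
        exact Set.mem_singleton_iff.2 ((e.symm_apply_apply v).symm.trans (congrArg e.symm hv))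
    · exact ⟨fun a b => by rw [Subsingleton.elim a b]⟩
  adj_iff := by
    intro r r'
    constructor
    · intro h
      exact ⟨h.ne, ⟨e.symm r, trivial⟩, ⟨e.symm r', trivial⟩, e.apply_symm_apply r,
        e.apply_symm_apply r', (e.symm.map_adj_iff).2 h⟩
    · rintro ⟨-, a, b, rfl, rfl, h⟩
      exact (e.map_adj_iff).2 h

/-- The tree `R` of a correspondence `(R ↞ S ↪ T)` is connected. -/
theorem target_connected {W V : Type u} {R : SimpleGraph W} {T : SimpleGraph V}
    (p : Correspondence R T) : R.Connected := by
  have key : ∀ a b : p.S, (T.induce p.S).Reachable a b → R.Reachable (p.d a) (p.d b) := by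
    rintro a b ⟨walk⟩
    induction walk with
    | nil => exact SimpleGraph.Reachable.refl _
    | @cons x y z hadj _ ih =>
      refine SimpleGraph.Reachable.trans ?_ ih
      by_cases h : p.d x = p.d y
      · rw [h]
      · exact ((p.adj_iff _ _).2 ⟨h, x, y, rfl, rfl, hadj⟩).reachable
  obtain ⟨a⟩ := p.connected.nonempty
  have : Nonempty W := ⟨p.d a⟩
  refine ⟨fun r r' => ?_⟩
  obtain ⟨s, rfl⟩ := p.surjective r
  obtain ⟨s', rfl⟩ := p.surjective r'
  exact key s s' (p.connected.preconnected s s')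

/-- Two correspondences `(R ↞ S ↪ T)` and `(R' ↞ S' ↪ T)` are isomorphic if `S = S'` as subtrees
of `T` and there is an isomorphism `R ≃ R'` compatible with the quotient maps. -/
def Isomorphic {W W' V : Type u} {R : SimpleGraph W} {R' : SimpleGraph W'} {T : SimpleGraph V}
    (p : Correspondence R T) (p' : Correspondence R' T) : Prop :=
  p.S = p'.S ∧ ∃ e : R ≃g R', ∀ (v : V) (h : v ∈ p.S) (h' : v ∈ p'.S),
    e (p.d ⟨v, h⟩) = p'.d ⟨v, h'⟩

/-- A correspondence is determined up to isomorphism by its set `S` and the fibers of `d`. -/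
theorem Isomorphic.of_fibers {W W' V : Type u} {R : SimpleGraph W} {R' : SimpleGraph W'}
    {T : SimpleGraph V} {p : Correspondence R T} {p' : Correspondence R' T} (hS : p.S = p'.S)
    (hd : ∀ (a b : V) (ha : a ∈ p.S) (hb : b ∈ p.S) (ha' : a ∈ p'.S) (hb' : b ∈ p'.S),
      p.d ⟨a, ha⟩ = p.d ⟨b, hb⟩ ↔ p'.d ⟨a, ha'⟩ = p'.d ⟨b, hb'⟩) : p.Isomorphic p' := by
  obtain ⟨S, hc, d, hs, hf, hadj⟩ := p
  obtain ⟨S', hc', d', hs', hf', hadj'⟩ := p'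
  obtain rfl : S = S' := hS
  simp only at hd
  have ⟨s, hs1⟩ := hs.hasRightInverse
  have ⟨s', hs1'⟩ := hs'.hasRightInverse
  have key : ∀ a b : S, d a = d b ↔ d' a = d' b := fun a b => hd a b a.2 b.2 a.2 b.2
  let e : W ≃ W' :=
    { toFun := fun w => d' (s w)
      invFun := fun w => d (s' w)
      left_inv := fun w => by
        rw [← hs1 w, key, hs1' _, hs1 w]
      right_inv := fun w => by
        rw [← hs1' w, ← key, hs1 _, hs1' w] }
  have he : ∀ v : S, e (d v) = d' v := fun v => (key _ _).1 (hs1 (d v))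
  refine ⟨rfl, ⟨e, ?_⟩, fun v h _ => he ⟨v, h⟩⟩
  intro w w'
  rw [hadj, hadj', e.injective.ne_iff]
  refine and_congr_right fun _ => exists_congr fun a => exists_congr fun b => ?_
  rw [← he a, ← he b, e.apply_eq_iff_eq, e.apply_eq_iff_eq]

theorem Isomorphic.fibers {W W' V : Type u} {R : SimpleGraph W} {R' : SimpleGraph W'}
    {T : SimpleGraph V} {p : Correspondence R T} {p' : Correspondence R' T} (h : p.Isomorphic p')
    (a b : V) (ha : a ∈ p.S) (hb : b ∈ p.S) (ha' : a ∈ p'.S) (hb' : b ∈ p'.S) :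
    p.d ⟨a, ha⟩ = p.d ⟨b, hb⟩ ↔ p'.d ⟨a, ha'⟩ = p'.d ⟨b, hb'⟩ := by
  obtain ⟨-, e, he⟩ := h
  rw [← he a ha ha', ← he b hb hb', EmbeddingLike.apply_eq_iff_eq]

end Correspondence

/-- A correspondence `(R ↞ S ↪ T)` with `R` not fixed. -/
structure SomeCorrespondence {V : Type u} (T : SimpleGraph V) where
  W : Type u
  R : SimpleGraph W
  corr : Correspondence R T

/-- Isomorphism of correspondences. -/
instance SomeCorrespondence.setoid {V : Type u} (T : SimpleGraph V) :
    Setoid (SomeCorrespondence T) where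
  r := fun p p' => p.corr.Isomorphic p'.corr
  iseqv :=
    { refl := fun _ => Correspondence.Isomorphic.of_fibers rfl fun _ _ _ _ _ _ => Iff.rfl
      symm := fun {_ _} h => Correspondence.Isomorphic.of_fibers h.1.symm
        fun a b ha hb ha' hb' => (h.fibers a b ha' hb' ha hb).symm
      trans := fun {_ _ _} h h' => Correspondence.Isomorphic.of_fibers (h.1.trans h'.1)
        fun a b ha hb ha' hb' => (h.fibers a b ha hb (h.1 ▸ ha) (h.1 ▸ hb)).trans
          (h'.fibers a b (h.1 ▸ ha) (h.1 ▸ hb) ha' hb') }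

/-- The set `𝔓_T` of correspondences of trees `(R ↞ S ↪ T)`, up to isomorphism. -/
def CorrPoset {V : Type u} (T : SimpleGraph V) : Type (u + 1) :=
  Quotient (SomeCorrespondence.setoid T)

/-- The element of `𝔓_T` represented by a correspondence. -/
def Correspondence.toPoset {W V : Type u} {R : SimpleGraph W} {T : SimpleGraph V}
    (p : Correspondence R T) : CorrPoset T :=
  Quotient.mk _ ⟨W, R, p⟩

/-- `𝔭' ≤ 𝔭` if `𝔭 = 𝔮 ∘ 𝔭'` for a correspondence `𝔮 = (R ↞ Q ↪ R')`. -/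
instance {V : Type u} (T : SimpleGraph V) : LE (CorrPoset T) where
  le a b := ∃ (W W' : Type u) (R : SimpleGraph W) (R' : SimpleGraph W')
    (p' : Correspondence R' T) (q : Correspondence R R'),
      a = p'.toPoset ∧ b = (q.comp p').toPoset

theorem Correspondence.toPoset_eq_iff {W W' V : Type u} {R : SimpleGraph W} {R' : SimpleGraph W'}
    {T : SimpleGraph V} {p : Correspondence R T} {p' : Correspondence R' T} :
    p.toPoset = p'.toPoset ↔ p.Isomorphic p' :=
  ⟨fun h => Quotient.exact h, fun h => Quotient.sound h⟩

/-- If `𝔭' ≤ 𝔭` then `S ⊆ S'`, and the fibers of `𝔭'` meeting `S` lie in fibers of `𝔭`. -/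
theorem Correspondence.fibers_of_le {W W' V : Type u} {R : SimpleGraph W} {R' : SimpleGraph W'}
    {T : SimpleGraph V} {p : Correspondence R T} {p' : Correspondence R' T}
    (h : p'.toPoset ≤ p.toPoset) :
    p.S ⊆ p'.S ∧ ∀ (a b : V) (ha : a ∈ p.S) (hb : b ∈ p.S) (ha' : a ∈ p'.S) (hb' : b ∈ p'.S),
      p'.d ⟨a, ha'⟩ = p'.d ⟨b, hb'⟩ → p.d ⟨a, ha⟩ = p.d ⟨b, hb⟩ := by
  obtain ⟨W₁, W₂, R₁, R₂, p₂, q, h₁, h₂⟩ := h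
  rw [toPoset_eq_iff] at h₁ h₂
  have hsub : p.S ⊆ p₂.S := by
    rw [h₂.1]
    exact fun v hv => hv.1
  refine ⟨by rw [h₁.1]; exact hsub, fun a b ha hb ha' hb' hab => ?_⟩
  rw [h₂.fibers a b ha hb (h₂.1 ▸ ha) (h₂.1 ▸ hb)]
  rw [h₁.fibers a b ha' hb' (hsub ha) (hsub hb)] at hab
  show q.d _ = q.d _
  congr 1
  exact Subtype.ext hab

instance {V : Type u} (T : SimpleGraph V) : PartialOrder (CorrPoset T) where
  le_refl := by
    rintro ⟨⟨W, R, p⟩⟩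
    refine ⟨W, W, R, R, p, Correspondence.ofIso p.target_connected SimpleGraph.Iso.refl, rfl, ?_⟩
    refine Correspondence.toPoset_eq_iff.2 (Correspondence.Isomorphic.of_fibers ?_ ?_)
    · ext v
      exact ⟨fun h => ⟨h, trivial⟩, fun h => h.1⟩
    · intro a b ha hb ha' hb'
      exact Iff.rfl
  le_trans := by
    rintro a b c ⟨W₁, W₂, R₁, R₂, p, q, rfl, rfl⟩ ⟨W₃, W₄, R₃, R₄, p', q', h, rfl⟩
    have h' := Correspondence.toPoset_eq_iff.1 h
    obtain ⟨hS, e, he⟩ := h'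
    refine ⟨W₃, W₂, R₃, R₂, p,
      (q'.comp (Correspondence.ofIso q.target_connected e)).comp q, rfl, ?_⟩
    refine Correspondence.toPoset_eq_iff.2 (Correspondence.Isomorphic.of_fibers ?_ ?_)
    · ext v
      constructor
      · rintro ⟨h1, h2⟩
        have h3 : v ∈ (q.comp p).S := hS ▸ h1
        refine ⟨h3.1, h3.2, trivial, ?_⟩
        have := he v h3 h1
        rw [← this] at h2
        exact h2
      · rintro ⟨h1, h2, h3, h4⟩
        have h5 : v ∈ (q.comp p).S := ⟨h1, h2⟩
        have h6 : v ∈ p'.S := hS ▸ h5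
        refine ⟨h6, ?_⟩
        rw [← he v h5 h6]
        exact h4
    · intro a b ha hb ha' hb'
      have h5 : a ∈ (q.comp p).S := ⟨ha'.1, ha'.2.1⟩
      have h6 : b ∈ (q.comp p).S := ⟨hb'.1, hb'.2.1⟩
      have e1 := he a h5 ha.1
      have e2 := he b h6 hb.1
      have key : ∀ (x : V) (hx : x ∈ (q'.comp p').S)
          (hx' : x ∈ (((q'.comp (Correspondence.ofIso q.target_connected e)).comp q).comp p).S),
          (q'.comp p').d ⟨x, hx⟩ =
          (((q'.comp (Correspondence.ofIso q.target_connected e)).comp q).comp p).d ⟨x, hx'⟩ := by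
        intro x hx hx'
        have hx5 : x ∈ (q.comp p).S := ⟨hx'.1, hx'.2.1⟩
        show q'.d _ = q'.d _
        congr 1
        exact Subtype.ext (he x hx5 hx.1).symm
      rw [key a ha ha', key b hb hb']
  le_antisymm := by
    rintro ⟨⟨W, R, p⟩⟩ ⟨⟨W', R', p'⟩⟩ h h'
    have h1 := Correspondence.fibers_of_le (p := p') (p' := p) h
    have h2 := Correspondence.fibers_of_le (p := p) (p' := p') h'
    exact Correspondence.toPoset_eq_iff.2 (Correspondence.Isomorphic.of_fibers
      (Set.Subset.antisymm h2.1 h1.1) fun a b ha hb ha' hb' =>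
        ⟨h1.2 a b ha' hb' ha hb, h2.2 a b ha hb ha' hb'⟩)

/-! ### The cells of the arboreal singularity -/

/-- `v_x(α) = yes`: the vertices `α` with `x ∈ L_T(α) ⊆ L_T`. -/
def pointVertices {V : Type u} {T : SimpleGraph V} (x : Singularity T) : Set V :=
  {α | x ∈ Set.range (chart T α)}

/-- `e_x({α, β}) = +`: the point `x` lies in `L_T(α)` and `L_T(β)`, where `{α, β}` is an edge, and
`x_β(α) = x_α(β) > 0` at `x`. -/
def PosEdge {V : Type u} {T : SimpleGraph V} (x : Singularity T) (α β : V) : Prop :=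
  ∃ (h : T.Adj α β) (u : Chart α) (w : Chart β), chart T α u = x ∧ chart T β w = x ∧
    u ⟨β, h.ne'⟩ = w ⟨α, h.ne⟩ ∧ 0 < u ⟨β, h.ne'⟩

/-- The set of points `x` of `L_T` that lead to the correspondence `p = (R ↞ S ↪ T)`: the
vertices of `S` are those with `v_x = yes`, and two of them have the same image in `R` exactly
when they are connected by a path of edges with `e_x = +`. -/
def Correspondence.cell {W V : Type u} {R : SimpleGraph W} {T : SimpleGraph V}
    (p : Correspondence R T) : Set (Singularity T) :=
  {x | p.S = pointVertices x ∧
    ∀ a b : p.S, p.d a = p.d b ↔ Relation.EqvGen (PosEdge x) (a : V) (b : V)}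

theorem Correspondence.cell_subset_of_isomorphic {W W' V : Type u} {R : SimpleGraph W}
    {R' : SimpleGraph W'} {T : SimpleGraph V} {p : Correspondence R T} {p' : Correspondence R' T}
    (h : p.Isomorphic p') : p.cell ⊆ p'.cell := fun _ hx =>
  have hS : ∀ a : p'.S, (a : V) ∈ p.S := fun a => by rw [h.1]; exact a.2
  ⟨h.1.symm.trans hx.1, fun a b =>
    (h.fibers a b (hS a) (hS b) a.2 b.2).symm.trans (hx.2 ⟨a, hS a⟩ ⟨b, hS b⟩)⟩

/-- The cell `L_T(𝔭) ⊆ L_T` for `𝔭 ∈ 𝔓_T`. -/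
def CorrPoset.cell {V : Type u} {T : SimpleGraph V} (a : CorrPoset T) : Set (Singularity T) :=
  Quotient.lift (fun p : SomeCorrespondence T => p.corr.cell)
    (fun _ _ h => Set.Subset.antisymm (Correspondence.cell_subset_of_isomorphic h)
      (Correspondence.cell_subset_of_isomorphic (Setoid.symm h))) a

/-- The neighborhood `L_T(≥ 𝔭) ⊆ L_T`, the union of the cells `L_T(𝔮)` for `𝔮 ≥ 𝔭`. -/
def CorrPoset.star {V : Type u} {T : SimpleGraph V} (a : CorrPoset T) : Set (Singularity T) :=
  ⋃ b ∈ Set.Ici a, b.cell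

end Arboreal

/-! In a tree, sending γ ≠ α to the first edge on the path from γ to α is a bijection onto the edge
set E, so every chart L_T(α) becomes ℝ^E. In these coordinates an edge gluing identifies equal
weight vectors whose weight on that edge is nonnegative (`glue_iff`). A point of L_T is therefore a
weight vector w together with a component of the graph of edges with w ≥ 0 (`point_eq_iff`). This
component is its S, and the fibers of its quotient map are the components of the edges with w > 0
inside S.

Let p = (R ↞ S ↪ T). Each edge of R lifts to a unique edge of S, and the cell of p is cut out by
signs: weight 0 on the lifts, positive on contracted edges, negative on edges leaving S, free
elsewhere. A point (α, u) with α ∈ S has under it the point of L_R in the chart d α whose weights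
are those of u on the lifts; let Q be the subtree of R to which that point leads. Then (α, u) lies
in the star of p exactly when the sign conditions hold on the contracted and border edges touching
fibers over Q; on the other such edges the weight is free (`mem_star_iff`). Its cell is read off
from L_R (`InStar.mem_cell_comp_iff`).

The homeomorphism must thus open the half-line σx > 0 (σ = ±1) to all of ℝ, continuously, once the
vertex r of R under the edge leaves Q. The function `gap` supplies a continuous t ≥ 0 on L_R
vanishing exactly when r ∈ Q. The map x ↦ x - t/x is a bijection from σx > 0 onto ℝ if t > 0 and is
the identity if t = 0; its inverse is u ↦ (u + σ√(u² + 4t))/2. At the origin of L_R all gaps vanish,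
whence Ψ(x, 0) = x. Continuity passes to the quotients because `point` is proper
(`isProperMap_point`).

The poset isomorphism rests on the surjectivity of d, which lets p be cancelled from q ∘ p
(`comp_isomorphic_iff`). -/

namespace Arboreal

/-! ### Subgraphs cut out by a condition on edges -/

section SubEdges

variable {V : Type u} {T : SimpleGraph V}

/-- The subgraph of `T` formed by the edges satisfying `P`. -/
def subEdges (T : SimpleGraph V) (P : T.edgeSet → Prop) : SimpleGraph V where
  Adj a b := ∃ h : T.Adj a b, P ⟨s(a, b), h⟩
  symm := ⟨by
    rintro a b ⟨h, hp⟩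
    refine ⟨h.symm, ?_⟩
    have : (⟨s(b, a), h.symm⟩ : T.edgeSet) = ⟨s(a, b), h⟩ := Subtype.ext Sym2.eq_swap
    rwa [this]⟩
  loopless := ⟨fun _ h => h.1.ne rfl⟩

theorem subEdges_mono {P P' : T.edgeSet → Prop} (h : ∀ e, P e → P' e) :
    subEdges T P ≤ subEdges T P' := fun _ _ hab => ⟨hab.1, h _ hab.2⟩

theorem subEdges_le (P : T.edgeSet → Prop) : subEdges T P ≤ T := fun _ _ hab => hab.1

theorem reachable_induction {G : SimpleGraph V} {a b : V} (h : G.Reachable a b)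
    {motive : V → Prop} (base : motive a)
    (step : ∀ x y, G.Reachable a x → G.Adj x y → motive x → motive y) : motive b := by
  rw [SimpleGraph.reachable_iff_reflTransGen] at h
  induction h with
  | refl => exact base
  | tail h hxy ih => exact step _ _ ((SimpleGraph.reachable_iff_reflTransGen _ _).2 h) hxy ih

/-- In a forest the ends of an edge are separated by removing it. -/
theorem not_reachable_of_adj (hT : T.IsAcyclic) {a b : V} (h : T.Adj a b) :
    ¬ (subEdges T (· ≠ ⟨s(a, b), h⟩)).Reachable a b := by
  intro hr
  have := SimpleGraph.isAcyclic_iff_forall_adj_isBridge.1 hT h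
  rw [SimpleGraph.isBridge_iff] at this
  refine this (hr.mono fun x y hxy => ?_)
  rw [SimpleGraph.deleteEdges_adj]
  exact ⟨hxy.1, fun hmem => hxy.2 (Subtype.ext hmem)⟩

/-- In a forest, an edge whose ends are connected by edges satisfying `P` satisfies `P`. -/
theorem of_reachable_of_adj (hT : T.IsAcyclic) {P : T.edgeSet → Prop} {a b : V}
    (hr : (subEdges T P).Reachable a b) (h : T.Adj a b) : P ⟨s(a, b), h⟩ := by
  by_contra hP
  exact not_reachable_of_adj hT h
    (hr.mono (subEdges_mono fun e he => by rintro rfl; exact hP he))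

theorem isAcyclic_of_not_reachable
    (h : ∀ (a b : V) (h : T.Adj a b), ¬ (subEdges T (· ≠ ⟨s(a, b), h⟩)).Reachable a b) :
    T.IsAcyclic := by
  rw [SimpleGraph.isAcyclic_iff_forall_adj_isBridge]
  intro a b hab
  rw [SimpleGraph.isBridge_iff]
  intro hr
  refine h a b hab (hr.mono fun x y hxy => ?_)
  rw [SimpleGraph.deleteEdges_adj] at hxy
  exact ⟨hxy.1, fun he => hxy.2 (congrArg Subtype.val he)⟩

/-- In a tree, `a` and `b` are connected by edges satisfying `P` as soon as all edges separating
`a` from `b` satisfy `P`. -/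
theorem reachable_of_separating (hT : T.IsTree) {P : T.edgeSet → Prop} {a b : V}
    (h : ∀ e, ¬ (subEdges T (· ≠ e)).Reachable a b → P e) : (subEdges T P).Reachable a b := by
  classical
  obtain ⟨w, hw⟩ := (hT.connected.preconnected a b).exists_isPath
  refine ⟨w.transfer _ fun e he => ?_⟩
  have heT : e ∈ T.edgeSet := w.edges_subset_edgeSet he
  have hPe : P ⟨e, heT⟩ := by
    refine h _ fun hr => ?_
    obtain ⟨w', hw'⟩ := hr.exists_isPath
    have huniq := congrArg Subtype.val ((hT.isAcyclic.subsingleton_path a b).elim ⟨w, hw⟩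
      ⟨w'.mapLe (subEdges_le _), hw'.mapLe _⟩)
    simp only at huniq
    rw [huniq, SimpleGraph.Walk.edges_mapLe_eq_edges] at he
    have := w'.edges_subset_edgeSet he
    induction e with | _ x y => exact this.2 rfl
  induction e with | _ x y => exact ⟨heT, hPe⟩

/-- Removing an edge of a connected graph, every vertex stays connected to one of its ends. -/
theorem reachable_or_reachable (hT : T.Connected) {a b : V} (h : T.Adj a b) (c : V) :
    (subEdges T (· ≠ ⟨s(a, b), h⟩)).Reachable a c ∨
      (subEdges T (· ≠ ⟨s(a, b), h⟩)).Reachable b c := by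
  refine reachable_induction (motive := fun x =>
    (subEdges T (· ≠ ⟨s(a, b), h⟩)).Reachable a x ∨ (subEdges T (· ≠ ⟨s(a, b), h⟩)).Reachable b x)
    (hT.preconnected a c) (Or.inl (.refl _)) ?_
  intro x y _ hxy ih
  by_cases he : (⟨s(x, y), hxy⟩ : T.edgeSet) = ⟨s(a, b), h⟩
  · rcases Sym2.eq_iff.1 (congrArg Subtype.val he) with ⟨-, rfl⟩ | ⟨-, rfl⟩
    · exact Or.inr (.refl _)
    · exact Or.inl (.refl _)
  · have : (subEdges T (· ≠ ⟨s(a, b), h⟩)).Adj x y := ⟨hxy, he⟩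
    exact ih.imp (·.trans this.reachable) (·.trans this.reachable)

end SubEdges

/-! ### Edge coordinates -/

section EdgeCoordinates

variable {V : Type u} {T : SimpleGraph V}

/-- The first edge on the path from `γ` to `α` in a tree. -/
theorem existsUnique_edgeToward (hT : T.IsTree) {α γ : V} (h : γ ≠ α) :
    ∃! e : T.edgeSet, γ ∈ e.1 ∧ ¬ (subEdges T (· ≠ e)).Reachable α γ := by
  classical
  obtain ⟨w, hw⟩ := (hT.connected.preconnected γ α).exists_isPath
  cases w with
  | nil => exact absurd rfl h
  | @cons _ δ _ hadj w =>
    rw [SimpleGraph.Walk.cons_isPath_iff] at hw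
    -- A path visits `γ` only once, so its part after `δ` survives the removal of any edge at `γ`.
    have hδ : ∀ e : T.edgeSet, γ ∈ e.1 → (subEdges T (· ≠ e)).Reachable δ α := by
      intro e he
      refine ⟨w.transfer _ fun e' he' => ?_⟩
      have heT : e' ∈ T.edgeSet := w.edges_subset_edgeSet he'
      have hne : e' ≠ e.1 := by
        rintro rfl
        refine hw.2 ?_
        obtain ⟨x, hx⟩ := Sym2.mem_iff_exists.1 he
        rw [hx] at he'
        exact w.fst_mem_support_of_mem_edges he'
      induction e' with | _ x y => exact ⟨heT, fun h => hne (congrArg Subtype.val h)⟩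
    refine ⟨⟨s(γ, δ), hadj⟩, ⟨Sym2.mem_mk_left _ _, fun hr => ?_⟩, ?_⟩
    · exact not_reachable_of_adj hT.isAcyclic hadj
        ((hδ ⟨s(γ, δ), hadj⟩ (Sym2.mem_mk_left _ _)).trans hr).symm
    · rintro e ⟨he, hsep⟩
      by_contra hne
      refine hsep ((hδ e he).symm.trans (SimpleGraph.Adj.reachable ?_))
      refine ⟨hadj.symm, fun h => hne ?_⟩
      rw [← h]
      exact Subtype.ext Sym2.eq_swap

/-- The edge of a tree which leaves `γ` in the direction of `α`. -/
noncomputable def edgeToward (hT : T.IsTree) (α : V) (γ : {γ : V // γ ≠ α}) : T.edgeSet :=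
  (existsUnique_edgeToward hT γ.2).choose

theorem edgeToward_eq (hT : T.IsTree) {α : V} {γ : {γ : V // γ ≠ α}} {e : T.edgeSet}
    (h : γ.1 ∈ e.1) (h' : ¬ (subEdges T (· ≠ e)).Reachable α γ) : edgeToward hT α γ = e :=
  ((existsUnique_edgeToward hT γ.2).choose_spec.2 e ⟨h, h'⟩).symm

theorem mem_edgeToward (hT : T.IsTree) (α : V) (γ : {γ : V // γ ≠ α}) :
    γ.1 ∈ (edgeToward hT α γ).1 :=
  (existsUnique_edgeToward hT γ.2).choose_spec.1.1

theorem edgeToward_separates (hT : T.IsTree) (α : V) (γ : {γ : V // γ ≠ α}) :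
    ¬ (subEdges T (· ≠ edgeToward hT α γ)).Reachable α γ :=
  (existsUnique_edgeToward hT γ.2).choose_spec.1.2

theorem edgeToward_of_adj (hT : T.IsTree) {a b : V} (h : T.Adj a b) :
    edgeToward hT a ⟨b, h.ne'⟩ = ⟨s(a, b), h⟩ :=
  edgeToward_eq hT (Sym2.mem_mk_right _ _) (not_reachable_of_adj hT.isAcyclic h)

/-- The edge contains `γ`, so it is not {a, b}; hence a and b lie on the same side of it. -/
theorem edgeToward_congr (hT : T.IsTree) {a b : V} (h : T.Adj a b) {γ : V} (ha : γ ≠ a)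
    (hb : γ ≠ b) : edgeToward hT b ⟨γ, hb⟩ = edgeToward hT a ⟨γ, ha⟩ := by
  refine edgeToward_eq hT (mem_edgeToward hT a ⟨γ, ha⟩) fun hr => ?_
  refine edgeToward_separates hT a ⟨γ, ha⟩ (SimpleGraph.Reachable.trans ?_ hr)
  refine SimpleGraph.Adj.reachable ⟨h, fun he => ?_⟩
  have := mem_edgeToward hT a ⟨γ, ha⟩
  rw [← he, Sym2.mem_iff] at this
  exact this.elim ha hb

/-- Removing an edge cuts the tree in two; the preimage of the edge is its end on the side away from
`α`. -/
theorem edgeToward_bijective (hT : T.IsTree) (α : V) :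
    Function.Bijective (edgeToward hT α) := by
  constructor
  · intro γ γ' h
    by_contra hne
    have hne' : γ.1 ≠ γ'.1 := fun h' => hne (Subtype.ext h')
    have h1 := mem_edgeToward hT α γ
    have h2 := mem_edgeToward hT α γ'
    have h3 := edgeToward_separates hT α γ
    have h4 := edgeToward_separates hT α γ'
    rw [← h] at h2 h4
    generalize edgeToward hT α γ = e at *
    obtain ⟨e, he⟩ := e
    obtain rfl : e = s(γ.1, γ'.1) := (Sym2.mem_and_mem_iff hne').1 ⟨h1, h2⟩
    exact (reachable_or_reachable hT.connected he α).elim (fun h => h3 h.symm) (fun h => h4 h.symm)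
  · rintro ⟨e, he⟩
    induction e with | _ a b =>
    have hab : T.Adj a b := he
    by_cases hr : (subEdges T (· ≠ ⟨s(a, b), he⟩)).Reachable α a
    · have hb : ¬ (subEdges T (· ≠ ⟨s(a, b), he⟩)).Reachable α b := fun hb =>
        not_reachable_of_adj hT.isAcyclic hab (hr.symm.trans hb)
      exact ⟨⟨b, by rintro rfl; exact hb (.refl _)⟩,
        edgeToward_eq hT (Sym2.mem_mk_right _ _) hb⟩
    · exact ⟨⟨a, by rintro rfl; exact hr (.refl _)⟩,
        edgeToward_eq hT (Sym2.mem_mk_left _ _) hr⟩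

/-- The coordinates of `L_T(α)` are indexed by the edges of the tree `T`. -/
noncomputable def chartHomeo (hT : T.IsTree) (α : V) : (T.edgeSet → ℝ) ≃ₜ Chart α :=
  (Homeomorph.piCongrLeft (Y := fun _ => ℝ)
    (Equiv.ofBijective _ (edgeToward_bijective hT α))).symm

theorem chartHomeo_apply (hT : T.IsTree) (α : V) (w : T.edgeSet → ℝ) (γ : {γ : V // γ ≠ α}) :
    chartHomeo hT α w γ = w (edgeToward hT α γ) := rfl

theorem chartHomeo_symm_apply (hT : T.IsTree) (α : V) (u : Chart α) (γ : {γ : V // γ ≠ α}) :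
    (chartHomeo hT α).symm u (edgeToward hT α γ) = u γ := by
  rw [← chartHomeo_apply hT α ((chartHomeo hT α).symm u), Homeomorph.apply_symm_apply]

/-! ### Points, gluings and cells in edge coordinates. -/

/-- The subgraph of edges of nonnegative weight. -/
abbrev nonnegGraph (T : SimpleGraph V) (w : T.edgeSet → ℝ) : SimpleGraph V :=
  subEdges T fun e => 0 ≤ w e

/-- The subgraph of edges of positive weight. -/
abbrev posGraph (T : SimpleGraph V) (w : T.edgeSet → ℝ) : SimpleGraph V :=
  subEdges T fun e => 0 < w e

/-- The point of `L_T(α) ⊆ L_T` with given edge coordinates. -/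
noncomputable def point (hT : T.IsTree) (z : V × (T.edgeSet → ℝ)) : Singularity T :=
  chart T z.1 (chartHomeo hT z.1 z.2)

theorem chart_eq_point (hT : T.IsTree) (α : V) (u : Chart α) :
    chart T α u = point hT (α, (chartHomeo hT α).symm u) := by
  simp [point]

theorem chart_zero (hT : T.IsTree) (α : V) : chart T α 0 = point hT (α, 0) := rfl

theorem point_surjective (hT : T.IsTree) : Function.Surjective (point hT) := by
  rintro ⟨⟨α, u⟩⟩
  exact ⟨_, (chart_eq_point hT α u).symm⟩

/-- The coordinates x_β(α) and x_α(β) both belong to the edge {α, β}, and for other γ the two charts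
use the same edge by `edgeToward_congr`. -/
theorem glue_iff (hT : T.IsTree) (a b : Σ α : V, Chart α) :
    Glue T a b ↔ (chartHomeo hT a.1).symm a.2 = (chartHomeo hT b.1).symm b.2 ∧
      (nonnegGraph T ((chartHomeo hT a.1).symm a.2)).Adj a.1 b.1 := by
  obtain ⟨a, x⟩ := a
  obtain ⟨b, y⟩ := b
  obtain ⟨v, rfl⟩ := (chartHomeo hT a).surjective x
  obtain ⟨w, rfl⟩ := (chartHomeo hT b).surjective y
  simp only [Homeomorph.symm_apply_apply]
  have key : ∀ h : T.Adj a b, edgeToward hT b ⟨a, h.ne⟩ = ⟨s(a, b), h⟩ := fun h => by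
    rw [edgeToward_of_adj hT h.symm]
    exact Subtype.ext Sym2.eq_swap
  constructor
  · rintro ⟨h, h1, h2, h3⟩
    simp only [chartHomeo_apply, edgeToward_of_adj hT h, key h] at h1 h2 h3
    refine ⟨funext fun e => ?_, h, h2⟩
    obtain ⟨⟨γ, hγ⟩, rfl⟩ := (edgeToward_bijective hT a).surjective e
    by_cases hb : γ = b
    · subst hb
      rw [edgeToward_of_adj hT h, h1]
    · rw [h3 γ hγ hb, edgeToward_congr hT h hγ hb]
  · rintro ⟨rfl, h, h2⟩
    refine ⟨h, ?_, ?_, fun γ hγ hb => ?_⟩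
    · simp only [chartHomeo_apply, edgeToward_of_adj hT h, key h]
    · simpa only [chartHomeo_apply, edgeToward_of_adj hT h] using h2
    · simp only [chartHomeo_apply, edgeToward_congr hT h hγ hb]

theorem point_eq_iff (hT : T.IsTree) {α β : V} {v w : T.edgeSet → ℝ} :
    point hT (α, v) = point hT (β, w) ↔ v = w ∧ (nonnegGraph T v).Reachable α β := by
  constructor
  · intro h
    have h' := Quot.eqvGen_exact h
    have key : ∀ a b : Σ α : V, Chart α, Relation.EqvGen (Glue T) a b →
        (chartHomeo hT a.1).symm a.2 = (chartHomeo hT b.1).symm b.2 ∧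
        (nonnegGraph T ((chartHomeo hT a.1).symm a.2)).Reachable a.1 b.1 := by
      intro a b hab
      induction hab with
      | rel a b hab => exact ((glue_iff hT a b).1 hab).imp_right SimpleGraph.Adj.reachable
      | refl a => exact ⟨rfl, .refl _⟩
      | symm a b _ ih => exact ⟨ih.1.symm, by rw [← ih.1]; exact ih.2.symm⟩
      | trans a b c _ _ ih ih' =>
        exact ⟨ih.1.trans ih'.1, ih.2.trans (by rw [ih.1]; exact ih'.2)⟩
    simpa using key _ _ h'
  · rintro ⟨rfl, h⟩
    refine reachable_induction (motive := fun x => point hT (α, v) = point hT (x, v)) h rfl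
      fun x y _ hxy ih => ih.trans (Quot.sound ?_)
    rw [glue_iff hT]
    simpa using hxy

theorem mem_pointVertices (hT : T.IsTree) {α β : V} {w : T.edgeSet → ℝ} :
    β ∈ pointVertices (point hT (α, w)) ↔ (nonnegGraph T w).Reachable α β := by
  constructor
  · rintro ⟨u, hu⟩
    rw [chart_eq_point hT, eq_comm, point_eq_iff] at hu
    exact hu.2
  · intro h
    exact ⟨chartHomeo hT β w, ((point_eq_iff hT).2 ⟨rfl, h⟩).symm⟩

theorem posEdge_iff (hT : T.IsTree) {α a b : V} {w : T.edgeSet → ℝ} :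
    PosEdge (point hT (α, w)) a b ↔
      (nonnegGraph T w).Reachable α a ∧ (posGraph T w).Adj a b := by
  constructor
  · rintro ⟨h, u, -, hu, -, -, hpos⟩
    rw [chart_eq_point hT, eq_comm, point_eq_iff] at hu
    refine ⟨hu.2, h, ?_⟩
    rw [hu.1, ← edgeToward_of_adj hT]
    simpa only [chartHomeo_symm_apply] using hpos
  · rintro ⟨hr, h, hpos⟩
    have hb : (nonnegGraph T w).Adj a b := ⟨h, hpos.le⟩
    refine ⟨h, chartHomeo hT a w, chartHomeo hT b w, ((point_eq_iff hT).2 ⟨rfl, hr⟩).symm,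
      ((point_eq_iff hT).2 ⟨rfl, hr.trans hb.reachable⟩).symm, ?_, ?_⟩
    · rw [chartHomeo_apply, chartHomeo_apply, edgeToward_of_adj hT h, edgeToward_of_adj hT h.symm]
      exact congrArg w (Subtype.ext Sym2.eq_swap)
    · rwa [chartHomeo_apply, edgeToward_of_adj hT h]

theorem reachable_of_eqvGen_posEdge (hT : T.IsTree) {α a b : V} {w : T.edgeSet → ℝ}
    (h : Relation.EqvGen (PosEdge (point hT (α, w))) a b) : (posGraph T w).Reachable a b := by
  induction h with
  | rel a b h => exact ((posEdge_iff hT).1 h).2.reachable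
  | refl => exact .refl _
  | symm a b _ ih => exact ih.symm
  | trans a b c _ _ ih ih' => exact ih.trans ih'

/-- Positive edges are nonnegative, so a positive path from `a` never leaves the component of `α`,
as `PosEdge` requires. -/
theorem eqvGen_posEdge_iff (hT : T.IsTree) {α a b : V} {w : T.edgeSet → ℝ}
    (ha : (nonnegGraph T w).Reachable α a) :
    Relation.EqvGen (PosEdge (point hT (α, w))) a b ↔ (posGraph T w).Reachable a b := by
  refine ⟨reachable_of_eqvGen_posEdge hT, fun h => ?_⟩
  refine reachable_induction (motive := Relation.EqvGen (PosEdge (point hT (α, w))) a) h (.refl _)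
    fun x y hx hxy ih => ih.trans _ _ _ (.rel _ _ ?_)
  exact (posEdge_iff hT).2 ⟨ha.trans (hx.mono (subEdges_mono fun _ => le_of_lt)), hxy⟩

/-- The combinatorial description of the cells in edge coordinates. -/
theorem mem_cell_iff (hT : T.IsTree) {W : Type u} {R : SimpleGraph W} (p : Correspondence R T)
    {α : V} {w : T.edgeSet → ℝ} :
    point hT (α, w) ∈ p.cell ↔ (∀ β, β ∈ p.S ↔ (nonnegGraph T w).Reachable α β) ∧
      ∀ a b : p.S, p.d a = p.d b ↔ (posGraph T w).Reachable (a : V) b := by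
  have h1 : p.S = pointVertices (point hT (α, w)) ↔
      ∀ β, β ∈ p.S ↔ (nonnegGraph T w).Reachable α β := by
    rw [Set.ext_iff]
    exact forall_congr' fun β => by rw [mem_pointVertices]
  show (_ ∧ _) ↔ _
  rw [h1]
  refine and_congr_right fun h => forall_congr' fun a => forall_congr' fun b => ?_
  rw [eqvGen_posEdge_iff hT ((h a).1 a.2)]

end EdgeCoordinates

end Arboreal

namespace Arboreal

/-! ### The topology of the arboreal singularity -/

section PointTopology

variable {V : Type u} {T : SimpleGraph V}

theorem isClosed_singularity_iff (hT : T.IsTree) {A : Set (Singularity T)} :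
    IsClosed A ↔ ∀ α, IsClosed {w | point hT (α, w) ∈ A} := by
  have h1 : IsClosed A ↔ IsClosed ((Quot.mk (Glue T)) ⁻¹' A) :=
    (isQuotientMap_quot_mk (r := Glue T)).isClosed_preimage.symm
  rw [h1, isClosed_sigma_iff]
  refine forall_congr' fun α => ?_
  rw [← (chartHomeo hT α).isClosed_preimage]
  rfl

/-! ### The gap function and properness of the gluing map. -/

open Classical in
/-- The sum of the absolute values of the negative weights of the edges which separate `z.1`
from `r`. -/
noncomputable def gap (T : SimpleGraph V) (r : V) (z : V × (T.edgeSet → ℝ)) : ℝ :=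
  ∑ᶠ e, if (subEdges T (· ≠ e)).Reachable z.1 r then 0 else max 0 (-z.2 e)

open Classical in
theorem gap_summand_nonneg (r : V) (z : V × (T.edgeSet → ℝ)) (e : T.edgeSet) :
    0 ≤ if (subEdges T (· ≠ e)).Reachable z.1 r then 0 else max 0 (-z.2 e) := by
  split_ifs
  exacts [le_rfl, le_max_left _ _]

theorem gap_nonneg (r : V) (z : V × (T.edgeSet → ℝ)) : 0 ≤ gap T r z :=
  finsum_nonneg fun e => gap_summand_nonneg r z e

theorem continuous_gap [Finite V] [TopologicalSpace V] [DiscreteTopology V] (r : V) :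
    Continuous (gap T r) := by
  classical
  have := Fintype.ofFinite T.edgeSet
  refine continuous_prod_of_discrete_left.2 fun α => ?_
  simp only [gap, finsum_eq_sum_of_fintype]
  refine continuous_finsetSum _ fun e _ => ?_
  split_ifs <;> fun_prop

/-- Crossing an edge changes only whether that edge itself separates from `r`, and a nonnegative
edge contributes 0 in either case. -/
theorem gap_eq_of_reachable {r α β : V} {w : T.edgeSet → ℝ}
    (h : (nonnegGraph T w).Reachable α β) : gap T r (α, w) = gap T r (β, w) := by
  classical
  refine reachable_induction (motive := fun x => gap T r (α, w) = gap T r (x, w)) h rfl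
    fun x y _ hxy ih => ih.trans (finsum_congr fun e => ?_)
  by_cases he : (⟨s(x, y), hxy.1⟩ : T.edgeSet) = e
  · subst he
    have : max 0 (-w ⟨s(x, y), hxy.1⟩) = 0 := max_eq_left (neg_nonpos.2 hxy.2)
    simp [this]
  · have hadj : (subEdges T (· ≠ e)).Adj x y := ⟨hxy.1, he⟩
    have : (subEdges T (· ≠ e)).Reachable x r ↔ (subEdges T (· ≠ e)).Reachable y r :=
      ⟨hadj.symm.reachable.trans, hadj.reachable.trans⟩
    simp only [this]

theorem gap_self (α : V) (w : T.edgeSet → ℝ) : gap T α (α, w) = 0 := by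
  classical
  simp [gap]

theorem gap_eq_zero_iff [Finite V] (hT : T.IsTree) {r α : V} {w : T.edgeSet → ℝ} :
    gap T r (α, w) = 0 ↔ (nonnegGraph T w).Reachable α r := by
  classical
  refine ⟨fun h => reachable_of_separating hT fun e he => ?_,
    fun h => (gap_eq_of_reachable h).trans (gap_self r w)⟩
  have := Fintype.ofFinite T.edgeSet
  rw [gap, finsum_eq_sum_of_fintype,
    Finset.sum_eq_zero_iff_of_nonneg fun e _ => gap_summand_nonneg r (α, w) e] at h
  have h' := h e (Finset.mem_univ e)
  rw [if_neg he] at h'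
  simpa using h'

theorem gap_pos_iff [Finite V] (hT : T.IsTree) {r α : V} {w : T.edgeSet → ℝ} :
    0 < gap T r (α, w) ↔ ¬ (nonnegGraph T w).Reachable α r := by
  rw [← gap_eq_zero_iff hT, (gap_nonneg r (α, w)).lt_iff_ne, ne_comm]

/-- Fibers are finite: the weights are fixed and only the vertex varies. For closedness, the image
of a closed set meets each chart in a finite union of closed sets, the gluing condition being the
vanishing of a continuous `gap`. -/
theorem isProperMap_point [Finite V] [TopologicalSpace V] [DiscreteTopology V] (hT : T.IsTree) :
    IsProperMap (point hT) := by
  refine isProperMap_iff_isClosedMap_and_compact_fibers.2 ⟨?_, ?_, ?_⟩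
  · refine continuous_prod_of_discrete_left.2 fun α => continuous_iff_isClosed.2 fun A hA => ?_
    exact (isClosed_singularity_iff hT).1 hA α
  · intro A hA
    rw [isClosed_singularity_iff hT]
    intro β
    have : {w | point hT (β, w) ∈ point hT '' A} =
        ⋃ α, {w | (α, w) ∈ A} ∩ {w | gap T β (α, w) = 0} := by
      ext w
      simp only [Set.mem_ofPred_eq, Set.mem_image, Prod.exists, point_eq_iff, Set.mem_iUnion,
        Set.mem_inter_iff, gap_eq_zero_iff hT]
      constructor
      · rintro ⟨α, _, h, rfl, h'⟩
        exact ⟨α, h, h'⟩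
      · rintro ⟨α, h, h'⟩
        exact ⟨α, w, h, rfl, h'⟩
    rw [this]
    refine isClosed_iUnion_of_finite fun α => (hA.preimage (by fun_prop)).inter ?_
    exact isClosed_singleton.preimage ((continuous_gap β).comp (by fun_prop : Continuous (α, ·)))
  · intro x
    obtain ⟨⟨α, w⟩, rfl⟩ := point_surjective hT x
    refine (Set.Finite.subset (Set.finite_univ.prod (Set.finite_singleton w)) ?_).isCompact
    rintro ⟨β, v⟩ h
    exact ⟨trivial, ((point_eq_iff hT).1 h).1⟩

theorem isQuotientMap_point [Finite V] [TopologicalSpace V] [DiscreteTopology V] (hT : T.IsTree) :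
    IsQuotientMap (point hT) :=
  (isProperMap_point hT).isClosedMap.isQuotientMap (isProperMap_point hT).continuous
    (point_surjective hT)

/-- The edge coordinates of a point of the arboreal singularity. -/
noncomputable def weights (hT : T.IsTree) (x : Singularity T) : T.edgeSet → ℝ :=
  (Function.surjInv (point_surjective hT) x).2

theorem weights_point (hT : T.IsTree) (z : V × (T.edgeSet → ℝ)) : weights hT (point hT z) = z.2 :=
  ((point_eq_iff hT).1 (Function.surjInv_eq (point_surjective hT) (point hT z))).1

theorem continuous_weights [Finite V] (hT : T.IsTree) : Continuous (weights hT) := by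
  let _ : TopologicalSpace V := ⊥
  have : DiscreteTopology V := ⟨rfl⟩
  rw [(isQuotientMap_point hT).continuous_iff]
  exact continuous_snd.congr fun z => (weights_point hT z).symm

end PointTopology

end Arboreal

namespace Arboreal

/-! ### Edges of a tree and edges of a quotient of a subtree -/

namespace Correspondence

variable {V W : Type u} {T : SimpleGraph V} {R : SimpleGraph W}

theorem reachable_of_fiber (p : Correspondence R T) {P : T.edgeSet → Prop} {a b : p.S}
    (hab : p.d a = p.d b)
    (h : ∀ (x y : p.S) (hxy : T.Adj x y), p.d x = p.d a → p.d y = p.d a → P ⟨s(x, y), hxy⟩) :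
    (subEdges T P).Reachable (a : V) b := by
  have hr := (p.fiber_connected (p.d a)).preconnected ⟨a, a.2, rfl⟩ ⟨b, b.2, hab.symm⟩
  refine reachable_induction (motive := fun x => (subEdges T P).Reachable (a : V) x) hr (.refl _) ?_
  rintro ⟨x, hx, hx'⟩ ⟨y, hy, hy'⟩ - hxy ih
  have hxyT : T.Adj x y := hxy
  have hadj : (subEdges T P).Adj x y := ⟨hxyT, h ⟨x, hx⟩ ⟨y, hy⟩ hxyT hx' hy'⟩
  exact ih.trans hadj.reachable

theorem adj_map (p : Correspondence R T) {a b : p.S} (h : T.Adj a b) (hne : p.d a ≠ p.d b) :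
    R.Adj (p.d a) (p.d b) :=
  (p.adj_iff _ _).2 ⟨hne, a, b, rfl, rfl, h⟩

theorem exists_liftEdge (p : Correspondence R T) (e : R.edgeSet) :
    ∃ f : T.edgeSet, ∃ a b : p.S, f.1 = s(a.1, b.1) ∧ e.1 = s(p.d a, p.d b) := by
  obtain ⟨e, he⟩ := e
  induction e with | _ r r' =>
  obtain ⟨-, a, b, rfl, rfl, h⟩ := (p.adj_iff r r').1 he
  exact ⟨⟨s(a.1, b.1), h⟩, a, b, rfl, rfl⟩

/-- The edge of `S` lying over a given edge of the quotient `R`. -/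
noncomputable def liftEdge (p : Correspondence R T) (e : R.edgeSet) : T.edgeSet :=
  (p.exists_liftEdge e).choose

/-- Two different edges over the same edge of `R` would close up to a cycle through the two
connected fibers. -/
theorem lift_unique (p : Correspondence R T) (hT : T.IsAcyclic) {a b a' b' : p.S}
    (h : T.Adj a b) (h' : T.Adj a' b') (hne : p.d a ≠ p.d b) (ha : p.d a = p.d a')
    (hb : p.d b = p.d b') : s(a.1, b.1) = s(a'.1, b'.1) := by
  by_contra hs
  have hP : ∀ (x y : p.S) (hxy : T.Adj x y), p.d x = p.d y →
      (⟨s(x.1, y.1), hxy⟩ : T.edgeSet) ≠ ⟨s(a.1, b.1), h⟩ := by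
    intro x y hxy hd he
    rcases Sym2.eq_iff.1 (congrArg Subtype.val he) with ⟨hx, hy⟩ | ⟨hx, hy⟩
    · obtain rfl := Subtype.ext hx
      obtain rfl := Subtype.ext hy
      exact hne hd
    · obtain rfl := Subtype.ext hx
      obtain rfl := Subtype.ext hy
      exact hne hd.symm
  have h1 := p.reachable_of_fiber (P := (· ≠ ⟨s(a.1, b.1), h⟩)) ha
    fun x y hxy hx hy => hP x y hxy (hx.trans hy.symm)
  have h2 := p.reachable_of_fiber (P := (· ≠ ⟨s(a.1, b.1), h⟩)) hb
    fun x y hxy hx hy => hP x y hxy (hx.trans hy.symm)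
  have h3 : (subEdges T (· ≠ ⟨s(a.1, b.1), h⟩)).Adj a' b' :=
    ⟨h', fun he => hs (congrArg Subtype.val he).symm⟩
  exact not_reachable_of_adj hT h ((h1.trans h3.reachable).trans h2.symm)

theorem liftEdge_mk (p : Correspondence R T) (hT : T.IsAcyclic) {a b : p.S} (h : T.Adj a b)
    (hR : R.Adj (p.d a) (p.d b)) : p.liftEdge ⟨s(p.d a, p.d b), hR⟩ = ⟨s(a.1, b.1), h⟩ := by
  obtain ⟨a', b', hf, he⟩ := (p.exists_liftEdge ⟨s(p.d a, p.d b), hR⟩).choose_spec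
  have hadj : T.Adj a' b' := by
    have := (p.liftEdge ⟨s(p.d a, p.d b), hR⟩).2
    rwa [liftEdge, hf] at this
  refine Subtype.ext (hf.trans ?_)
  rcases Sym2.eq_iff.1 he with ⟨h1, h2⟩ | ⟨h1, h2⟩
  · exact (p.lift_unique hT h hadj hR.ne h1 h2).symm
  · exact Sym2.eq_swap.trans (p.lift_unique hT h hadj.symm hR.ne h1 h2).symm

theorem liftEdge_cases (p : Correspondence R T) (hT : T.IsAcyclic) (e : R.edgeSet) :
    ∃ (a b : p.S) (h : T.Adj a b) (hR : R.Adj (p.d a) (p.d b)), e = ⟨s(p.d a, p.d b), hR⟩ ∧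
      p.liftEdge e = ⟨s(a.1, b.1), h⟩ := by
  obtain ⟨e, he⟩ := e
  induction e with | _ r r' =>
  obtain ⟨-, a, b, rfl, rfl, h⟩ := (p.adj_iff r r').1 he
  exact ⟨a, b, h, he, rfl, p.liftEdge_mk hT h he⟩

theorem liftEdge_injective (p : Correspondence R T) (hT : T.IsAcyclic) :
    Function.Injective p.liftEdge := by
  intro e e' h
  obtain ⟨a, b, hab, hR, rfl, h1⟩ := p.liftEdge_cases hT e
  obtain ⟨a', b', hab', hR', rfl, h2⟩ := p.liftEdge_cases hT e'
  rw [h1, h2] at h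
  rcases Sym2.eq_iff.1 (congrArg Subtype.val h) with ⟨h3, h4⟩ | ⟨h3, h4⟩
  · obtain rfl := Subtype.ext h3
    obtain rfl := Subtype.ext h4
    rfl
  · obtain rfl := Subtype.ext h3
    obtain rfl := Subtype.ext h4
    exact Subtype.ext Sym2.eq_swap

/-- A walk in `R` is lifted edge by edge through `hcut`; consecutive lifts are joined inside a
fiber, and only fibers over vertices already reached are used, so `hin` is needed only there. -/
theorem reachable_of_reachable_map (p : Correspondence R T) (hT : T.IsAcyclic)
    {P : T.edgeSet → Prop} {P' : R.edgeSet → Prop} {a : p.S}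
    (hcut : ∀ e, P' e → P (p.liftEdge e))
    (hin : ∀ (x y : p.S) (hxy : T.Adj x y), p.d x = p.d y →
      (subEdges R P').Reachable (p.d a) (p.d x) → P ⟨s(x.1, y.1), hxy⟩)
    {b : p.S} (h : (subEdges R P').Reachable (p.d a) (p.d b)) :
    (subEdges T P).Reachable (a : V) b := by
  have hfib : ∀ b c : p.S, p.d b = p.d c → (subEdges R P').Reachable (p.d a) (p.d b) →
      (subEdges T P).Reachable (b : V) c := fun b c hbc hb =>
    p.reachable_of_fiber hbc fun x y hxy hx hy => hin x y hxy (hx.trans hy.symm) (by rwa [hx])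
  refine reachable_induction (motive := fun r => ∀ b : p.S, p.d b = r →
    (subEdges T P).Reachable (a : V) b) h ?_ ?_ b rfl
  · exact fun b hb => hfib a b hb.symm (.refl _)
  · intro r r' hr hadj ih c hc
    obtain ⟨-, x, y, rfl, rfl, hxy⟩ := (p.adj_iff r r').1 hadj.1
    have hxy' : (subEdges T P).Adj x y := by
      refine ⟨hxy, ?_⟩
      rw [← p.liftEdge_mk hT hxy hadj.1]
      exact hcut _ hadj.2
    exact ((ih x rfl).trans hxy'.reachable).trans
      (hfib y c hc.symm (hr.trans hadj.reachable))

/-- By `hbd` a walk starting at `a` cannot leave `p.S`. Its projection stands still on contracted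
edges and follows the lifted ones. -/
theorem reachable_map_of_reachable (p : Correspondence R T) (hT : T.IsAcyclic)
    {P : T.edgeSet → Prop} {P' : R.edgeSet → Prop} {a : p.S}
    (hcut : ∀ e, P (p.liftEdge e) → P' e)
    (hbd : ∀ (x : p.S) (y : V) (hxy : T.Adj x y), y ∉ p.S →
      (subEdges R P').Reachable (p.d a) (p.d x) → ¬ P ⟨s(x.1, y), hxy⟩)
    {b : V} (h : (subEdges T P).Reachable (a : V) b) :
    ∃ hb : b ∈ p.S, (subEdges R P').Reachable (p.d a) (p.d ⟨b, hb⟩) := by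
  refine reachable_induction (motive := fun b =>
    ∃ hb : b ∈ p.S, (subEdges R P').Reachable (p.d a) (p.d ⟨b, hb⟩)) h ⟨a.2, .refl _⟩ ?_
  rintro x y - ⟨hxy, hP⟩ ⟨hx, ih⟩
  have hy : y ∈ p.S := by
    by_contra hy
    exact hbd ⟨x, hx⟩ y hxy hy ih hP
  refine ⟨hy, ih.trans ?_⟩
  by_cases hd : p.d ⟨x, hx⟩ = p.d ⟨y, hy⟩
  · rw [hd]
  · have hR := p.adj_map (a := ⟨x, hx⟩) (b := ⟨y, hy⟩) hxy hd
    refine SimpleGraph.Adj.reachable ⟨hR, hcut _ ?_⟩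
    rwa [p.liftEdge_mk hT (a := ⟨x, hx⟩) (b := ⟨y, hy⟩) hxy hR]

/-- A detour in `R` around an edge would lift to a detour in `T` around its lift. -/
theorem target_isTree (p : Correspondence R T) (hT : T.IsTree) : R.IsTree := by
  refine ⟨p.target_connected, isAcyclic_of_not_reachable fun r r' hR hr => ?_⟩
  obtain ⟨-, a, b, rfl, rfl, h⟩ := (p.adj_iff r r').1 hR
  refine not_reachable_of_adj hT.isAcyclic h
    (p.reachable_of_reachable_map hT.isAcyclic (P' := (· ≠ ⟨s(p.d a, p.d b), hR⟩)) ?_ ?_ hr)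
  · intro e he he'
    rw [← p.liftEdge_mk hT.isAcyclic h hR] at he'
    exact he (p.liftEdge_injective hT.isAcyclic he')
  · intro x y hxy hd _ he
    rcases Sym2.eq_iff.1 (congrArg Subtype.val he) with ⟨hx, hy⟩ | ⟨hx, hy⟩
    · obtain rfl := Subtype.ext hx
      obtain rfl := Subtype.ext hy
      exact hR.ne hd
    · obtain rfl := Subtype.ext hx
      obtain rfl := Subtype.ext hy
      exact hR.ne hd.symm

/-! ### The sign and the slack of an edge -/

open Classical in
/-- The sign of the coordinate of an edge on the cell of `p`: `1` for the contracted edges,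
`-1` for the edges leaving `S`, and `0` for the others. -/
noncomputable def sgn (p : Correspondence R T) (e : T.edgeSet) : ℝ :=
  if ∀ v ∈ e.1, v ∈ p.S then
    if ∃ r, ∀ (v : V) (h : v ∈ p.S), v ∈ e.1 → p.d ⟨v, h⟩ = r then 1 else 0
  else if ∃ v ∈ e.1, v ∈ p.S then -1 else 0

theorem sgn_inner (p : Correspondence R T) {x y : p.S} (h : T.Adj x y) (hd : p.d x = p.d y) :
    p.sgn ⟨s(x.1, y.1), h⟩ = 1 := by
  rw [sgn, if_pos, if_pos]
  · refine ⟨p.d x, fun v hv hve => ?_⟩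
    rcases Sym2.mem_iff.1 hve with rfl | rfl
    exacts [rfl, hd.symm]
  · intro v hve
    rcases Sym2.mem_iff.1 hve with rfl | rfl
    exacts [x.2, y.2]

theorem sgn_border (p : Correspondence R T) {x : p.S} {y : V} (h : T.Adj x y) (hy : y ∉ p.S) :
    p.sgn ⟨s(x.1, y), h⟩ = -1 := by
  rw [sgn, if_neg, if_pos]
  · exact ⟨x, Sym2.mem_mk_left _ _, x.2⟩
  · exact fun hS => hy (hS y (Sym2.mem_mk_right _ _))

theorem sgn_liftEdge (p : Correspondence R T) (hT : T.IsAcyclic) (e : R.edgeSet) :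
    p.sgn (p.liftEdge e) = 0 := by
  obtain ⟨a, b, hab, hR, rfl, h1⟩ := p.liftEdge_cases hT e
  rw [h1, sgn, if_pos, if_neg]
  · rintro ⟨r, hr⟩
    exact hR.ne ((hr a a.2 (Sym2.mem_mk_left _ _)).trans (hr b b.2 (Sym2.mem_mk_right _ _)).symm)
  · intro v hve
    rcases Sym2.mem_iff.1 hve with rfl | rfl
    exacts [a.2, b.2]

theorem sgn_cases (p : Correspondence R T) {e : T.edgeSet} (he : p.sgn e ≠ 0) :
    (∃ (x y : p.S) (h : T.Adj x y), p.d x = p.d y ∧ e = ⟨s(x.1, y.1), h⟩) ∨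
      ∃ (x : p.S) (y : V) (h : T.Adj x y), y ∉ p.S ∧ e = ⟨s(x.1, y), h⟩ := by
  obtain ⟨e, heT⟩ := e
  induction e with | _ a b =>
  have hab : T.Adj a b := heT
  by_cases ha : a ∈ p.S <;> by_cases hb : b ∈ p.S
  · refine Or.inl ⟨⟨a, ha⟩, ⟨b, hb⟩, hab, ?_, rfl⟩
    by_contra hd
    refine he ?_
    rw [sgn, if_pos, if_neg]
    · rintro ⟨r, hr⟩
      exact hd ((hr a ha (Sym2.mem_mk_left _ _)).trans (hr b hb (Sym2.mem_mk_right _ _)).symm)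
    · intro v hve
      rcases Sym2.mem_iff.1 hve with rfl | rfl <;> assumption
  · exact Or.inr ⟨⟨a, ha⟩, b, hab, hb, rfl⟩
  · exact Or.inr ⟨⟨b, hb⟩, a, hab.symm, ha, Subtype.ext Sym2.eq_swap⟩
  · refine absurd ?_ he
    rw [sgn, if_neg, if_neg]
    · rintro ⟨v, hve, hv⟩
      rcases Sym2.mem_iff.1 hve with rfl | rfl <;> contradiction
    · exact fun h => ha (h a (Sym2.mem_mk_left _ _))

theorem sgn_mul_self (p : Correspondence R T) {e : T.edgeSet} (he : p.sgn e ≠ 0) :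
    p.sgn e * p.sgn e = 1 := by
  rcases p.sgn_cases he with ⟨x, y, h, hd, rfl⟩ | ⟨x, y, h, hy, rfl⟩
  · rw [p.sgn_inner h hd, one_mul]
  · rw [p.sgn_border h hy]
    norm_num

open Classical in
/-- For an edge `e` with a sign, with an end in the fiber over `r`: the gap between `r` and a
point of the arboreal singularity of `R`. -/
noncomputable def slack (p : Correspondence R T) (e : T.edgeSet) (z : W × (R.edgeSet → ℝ)) : ℝ :=
  if p.sgn e = 0 then 0 else
    if h : ∃ v : p.S, v.1 ∈ e.1 then gap R (p.d h.choose) z else 0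

theorem slack_of_sgn_eq_zero (p : Correspondence R T) {e : T.edgeSet} (he : p.sgn e = 0)
    (z : W × (R.edgeSet → ℝ)) : p.slack e z = 0 := if_pos he

/-- The end chosen in `slack` is immaterial, as both ends lie in one fiber; in `slack_border` only
one end lies in `p.S`. -/
theorem slack_inner (p : Correspondence R T) {x y : p.S} (h : T.Adj x y) (hd : p.d x = p.d y)
    (z : W × (R.edgeSet → ℝ)) : p.slack ⟨s(x.1, y.1), h⟩ z = gap R (p.d x) z := by
  have hex : ∃ v : p.S, v.1 ∈ s(x.1, y.1) := ⟨x, Sym2.mem_mk_left _ _⟩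
  rw [slack, if_neg (by rw [p.sgn_inner h hd]; exact one_ne_zero), dif_pos hex]
  rcases Sym2.mem_iff.1 hex.choose_spec with h' | h'
  · rw [Subtype.ext h']
  · rw [Subtype.ext h', hd]

theorem slack_border (p : Correspondence R T) {x : p.S} {y : V} (h : T.Adj x y) (hy : y ∉ p.S)
    (z : W × (R.edgeSet → ℝ)) : p.slack ⟨s(x.1, y), h⟩ z = gap R (p.d x) z := by
  have hex : ∃ v : p.S, v.1 ∈ s(x.1, y) := ⟨x, Sym2.mem_mk_left _ _⟩
  rw [slack, if_neg (by rw [p.sgn_border h hy]; norm_num), dif_pos hex]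
  rcases Sym2.mem_iff.1 hex.choose_spec with h' | h'
  · rw [Subtype.ext h']
  · exact absurd (h' ▸ hex.choose.2) hy

theorem slack_nonneg (p : Correspondence R T) (e : T.edgeSet) (z : W × (R.edgeSet → ℝ)) :
    0 ≤ p.slack e z := by
  rw [slack]
  split_ifs
  exacts [le_rfl, gap_nonneg _ _, le_rfl]

theorem continuous_slack [Finite W] [TopologicalSpace W] [DiscreteTopology W]
    (p : Correspondence R T) (e : T.edgeSet) : Continuous (p.slack e) := by
  unfold slack
  split_ifs
  exacts [continuous_const, continuous_gap _, continuous_const]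

theorem slack_eq_of_reachable (p : Correspondence R T) (e : T.edgeSet) {q q' : W}
    {v : R.edgeSet → ℝ} (h : (nonnegGraph R v).Reachable q q') :
    p.slack e (q, v) = p.slack e (q', v) := by
  unfold slack
  split_ifs
  exacts [rfl, gap_eq_of_reachable h, rfl]

end Correspondence

end Arboreal

namespace Arboreal

namespace Correspondence

variable {V W : Type u} {T : SimpleGraph V} {R : SimpleGraph W}

/-! ### The star of a cell in edge coordinates -/

/-- The point of `L_R` under the point of `L_T` with edge coordinates `u`. -/
noncomputable def restrictWeights (p : Correspondence R T) (u : T.edgeSet → ℝ) : R.edgeSet → ℝ :=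
  fun e => u (p.liftEdge e)

/-- The condition on the edge coordinates `u` of a point of `L_T(α)` to lie in `L_T(≥ p)`. -/
def InStar (p : Correspondence R T) (α : p.S) (u : T.edgeSet → ℝ) : Prop :=
  ∀ e, p.sgn e ≠ 0 → 0 < p.slack e (p.d α, p.restrictWeights u) ∨ 0 < p.sgn e * u e

variable {p : Correspondence R T} {α : p.S} {u : T.edgeSet → ℝ}

theorem InStar.pos_of_inner [Finite W] (hu : p.InStar α u) (hR : R.IsTree) {x y : p.S}
    (h : T.Adj x y) (hd : p.d x = p.d y)
    (hr : (nonnegGraph R (p.restrictWeights u)).Reachable (p.d α) (p.d x)) :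
    0 < u ⟨s(x.1, y.1), h⟩ := by
  have h1 := p.sgn_inner h hd
  have := hu ⟨s(x.1, y.1), h⟩ (by rw [h1]; exact one_ne_zero)
  rw [p.slack_inner h hd, (gap_eq_zero_iff hR).2 hr, h1, one_mul] at this
  exact this.resolve_left (lt_irrefl _)

theorem InStar.neg_of_border [Finite W] (hu : p.InStar α u) (hR : R.IsTree) {x : p.S} {y : V}
    (h : T.Adj x y) (hy : y ∉ p.S)
    (hr : (nonnegGraph R (p.restrictWeights u)).Reachable (p.d α) (p.d x)) :
    u ⟨s(x.1, y), h⟩ < 0 := by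
  have h1 := p.sgn_border h hy
  have := hu ⟨s(x.1, y), h⟩ (by rw [h1]; norm_num)
  rw [p.slack_border h hy, (gap_eq_zero_iff hR).2 hr, h1, neg_one_mul, neg_pos] at this
  exact this.resolve_left (lt_irrefl _)

/-- The condition `P` is pinned down only up to edges of weight 0, so as to cover both `nonnegGraph`
and `posGraph`. Over the vertices reached the slack vanishes, and the star condition then gives the
signs that the two lifting lemmas need. -/
theorem InStar.reachable_iff [Finite W] (hu : p.InStar α u) (hT : T.IsTree)
    {P : T.edgeSet → Prop} {P' : R.edgeSet → Prop} (hcut : ∀ e, P (p.liftEdge e) ↔ P' e)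
    (hP' : ∀ e, P' e → 0 ≤ p.restrictWeights u e) (hpos : ∀ e, 0 < u e → P e)
    (hneg : ∀ e, u e < 0 → ¬ P e) {a : p.S} {b : V}
    (ha : (nonnegGraph R (p.restrictWeights u)).Reachable (p.d α) (p.d a)) :
    (subEdges T P).Reachable (a : V) b ↔
      ∃ hb : b ∈ p.S, (subEdges R P').Reachable (p.d a) (p.d ⟨b, hb⟩) := by
  have hR := p.target_isTree hT
  have hr : ∀ {r}, (subEdges R P').Reachable (p.d a) r →
      (nonnegGraph R (p.restrictWeights u)).Reachable (p.d α) r := fun h =>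
    ha.trans (h.mono (subEdges_mono hP'))
  constructor
  · exact p.reachable_map_of_reachable hT.isAcyclic (fun e => (hcut e).1)
      fun x y hxy hy h => hneg _ (hu.neg_of_border hR hxy hy (hr h))
  · rintro ⟨hb, h⟩
    exact p.reachable_of_reachable_map hT.isAcyclic (fun e => (hcut e).2)
      (fun x y hxy hd h' => hpos _ (hu.pos_of_inner hR hxy hd (hr h'))) h

theorem InStar.nonneg_reachable_iff [Finite W] (hu : p.InStar α u) (hT : T.IsTree) {b : V} :
    (nonnegGraph T u).Reachable (α : V) b ↔
      ∃ hb : b ∈ p.S, (nonnegGraph R (p.restrictWeights u)).Reachable (p.d α) (p.d ⟨b, hb⟩) :=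
  hu.reachable_iff hT (fun _ => Iff.rfl) (fun _ => id) (fun _ => le_of_lt) (fun _ => not_le_of_gt)
    (.refl _)

theorem InStar.pos_reachable_iff [Finite W] (hu : p.InStar α u) (hT : T.IsTree) {a b : p.S}
    (ha : (nonnegGraph R (p.restrictWeights u)).Reachable (p.d α) (p.d a)) :
    (posGraph T u).Reachable (a : V) b ↔
      (posGraph R (p.restrictWeights u)).Reachable (p.d a) (p.d b) :=
  (hu.reachable_iff hT (P := fun e => 0 < u e) (P' := fun e => 0 < p.restrictWeights u e)
    (fun _ => Iff.rfl) (fun _ => le_of_lt) (fun _ => id) (fun _ => lt_asymm) ha).trans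
    ⟨fun h => h.2, fun h => ⟨b.2, h⟩⟩

theorem InStar.mem_cell_comp_iff [Finite W] (hu : p.InStar α u) (hT : T.IsTree) (hR : R.IsTree)
    {U : Type u} {P : SimpleGraph U} (q : Correspondence P R) :
    point hT (α.1, u) ∈ (q.comp p).cell ↔
      point hR (p.d α, p.restrictWeights u) ∈ q.cell := by
  rw [mem_cell_iff, mem_cell_iff]
  constructor
  · rintro ⟨h1, h2⟩
    have h1' : ∀ β, β ∈ q.S ↔ (nonnegGraph R (p.restrictWeights u)).Reachable (p.d α) β := by
      intro r
      obtain ⟨b, rfl⟩ := p.surjective r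
      have := (h1 b).trans (hu.nonneg_reachable_iff hT)
      exact ⟨fun h => (this.1 ⟨b.2, h⟩).2, fun h => (this.2 ⟨b.2, h⟩).2⟩
    refine ⟨h1', ?_⟩
    rintro ⟨r, hr⟩ ⟨r', hr'⟩
    obtain ⟨a, rfl⟩ := p.surjective r
    obtain ⟨b, rfl⟩ := p.surjective r'
    exact (h2 ⟨a, a.2, hr⟩ ⟨b, b.2, hr'⟩).trans (hu.pos_reachable_iff hT ((h1' _).1 hr))
  · rintro ⟨h1, h2⟩
    refine ⟨fun b => ?_, ?_⟩
    · rw [hu.nonneg_reachable_iff hT]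
      exact exists_congr fun hb => h1 _
    · rintro ⟨a, ha, ha'⟩ ⟨b, hb, hb'⟩
      refine (h2 ⟨_, ha'⟩ ⟨_, hb'⟩).trans (Iff.symm ?_)
      exact hu.pos_reachable_iff hT (a := ⟨a, ha⟩) (b := ⟨b, hb⟩) ((h1 _).1 ha')

theorem inStar_of_mem_cell_comp [Finite W] (hT : T.IsTree) {U : Type u} {P : SimpleGraph U}
    (q : Correspondence P R) {β : V} {w : T.edgeSet → ℝ}
    (h : point hT (β, w) ∈ (q.comp p).cell) : ∃ hβ : β ∈ p.S, p.InStar ⟨β, hβ⟩ w := by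
  rw [mem_cell_iff] at h
  obtain ⟨h1, h2⟩ := h
  have hR := p.target_isTree hT
  have hβ := (h1 β).2 (.refl _)
  refine ⟨hβ.1, fun e he => ?_⟩
  rw [or_iff_not_imp_left]
  intro hs
  -- A vertex of `R` where the gap vanishes lies in `q.S`, so the description of the cell of `q.comp
  -- p` controls the edges touching its fiber.
  have key : ∀ r, (nonnegGraph R (p.restrictWeights w)).Reachable (p.d ⟨β, hβ.1⟩) r →
      r ∈ q.S := by
    intro r hr
    refine reachable_induction (motive := fun r => r ∈ q.S) hr hβ.2 ?_
    intro r r' _ hadj hr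
    obtain ⟨-, x, y, rfl, rfl, hxy⟩ := (p.adj_iff r r').1 hadj.1
    have hx := (h1 x).1 ⟨x.2, hr⟩
    have hxy' : (nonnegGraph T w).Adj x y := by
      refine ⟨hxy, ?_⟩
      rw [← p.liftEdge_mk hT.isAcyclic hxy hadj.1]
      exact hadj.2
    exact ((h1 y).2 (hx.trans hxy'.reachable)).2
  rcases p.sgn_cases he with ⟨x, y, hxy, hd, rfl⟩ | ⟨x, y, hxy, hy, rfl⟩
  · rw [p.slack_inner hxy hd, gap_pos_iff hR, not_not] at hs
    have hx := key _ hs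
    rw [p.sgn_inner hxy hd, one_mul]
    refine of_reachable_of_adj hT.isAcyclic (P := fun e => 0 < w e) ?_ hxy
    refine (h2 ⟨x, x.2, hx⟩ ⟨y, y.2, by rw [← Subtype.eta y y.2] at hd; exact hd ▸ hx⟩).1 ?_
    exact congrArg q.d (Subtype.ext hd)
  · rw [p.slack_border hxy hy, gap_pos_iff hR, not_not] at hs
    have hx := (h1 x).1 ⟨x.2, key _ hs⟩
    rw [p.sgn_border hxy hy, neg_one_mul, neg_pos]
    by_contra hw
    have hxy' : (nonnegGraph T w).Adj x y := ⟨hxy, not_lt.1 hw⟩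
    exact hy ((h1 y).2 (hx.trans hxy'.reachable)).1

/-! ### Every point leads to a correspondence -/

theorem connected_induce_of_reachable {G : SimpleGraph V} (hG : G ≤ T) {A : Set V} {a : V}
    (ha : a ∈ A) (hA : ∀ b ∈ A, G.Reachable a b) (hcl : ∀ x ∈ A, ∀ y, G.Adj x y → y ∈ A) :
    (T.induce A).Connected := by
  have key : ∀ b, G.Reachable a b → ∃ hb : b ∈ A, (T.induce A).Reachable ⟨a, ha⟩ ⟨b, hb⟩ := by
    intro b hb
    refine reachable_induction
      (motive := fun b => ∃ hb : b ∈ A, (T.induce A).Reachable ⟨a, ha⟩ ⟨b, hb⟩) hb ⟨ha, .refl _⟩ ?_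
    rintro x y - hxy ⟨hx, ih⟩
    have hy := hcl x hx y hxy
    have hadj : (T.induce A).Adj ⟨x, hx⟩ ⟨y, hy⟩ := hG hxy
    exact ⟨hy, ih.trans hadj.reachable⟩
  have : Nonempty A := ⟨⟨a, ha⟩⟩
  exact ⟨fun b c => (key b (hA b b.2)).2.symm.trans (key c (hA c c.2)).2⟩

/-- The subtree is the nonnegative component of `α`, and the quotient has as vertices the positive
components inside it. -/
theorem exists_mem_cell (hT : T.IsTree) (x : Singularity T) :
    ∃ (U : Type u) (P : SimpleGraph U) (q : Correspondence P T), x ∈ q.cell := by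
  obtain ⟨⟨α, w⟩, rfl⟩ := point_surjective hT x
  let C : Set V := {β | (nonnegGraph T w).Reachable α β}
  let f : C → (posGraph T w).ConnectedComponent := fun β => (posGraph T w).connectedComponentMk β
  let P : SimpleGraph (Set.range f) :=
    { Adj := fun r r' => r ≠ r' ∧ ∃ a b : C, Set.rangeFactorization f a = r ∧
        Set.rangeFactorization f b = r' ∧ T.Adj a b
      symm := ⟨fun r r' ⟨h, a, b, ha, hb, hab⟩ => ⟨h.symm, b, a, hb, ha, hab.symm⟩⟩
      loopless := ⟨fun r h => h.1 rfl⟩ }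
  have hf : ∀ a b : C, Set.rangeFactorization f a = Set.rangeFactorization f b ↔
      (posGraph T w).Reachable (a : V) b := fun a b => by
    rw [Subtype.ext_iff]
    exact SimpleGraph.ConnectedComponent.eq
  let q : Correspondence P T :=
    { S := C
      connected := connected_induce_of_reachable (subEdges_le _) (a := α)
        (SimpleGraph.Reachable.refl α) (fun _ => id) (fun x hx y hxy => hx.trans hxy.reachable)
      d := Set.rangeFactorization f
      surjective := Set.rangeFactorization_surjective
      fiber_connected := by
        intro r
        obtain ⟨a, rfl⟩ := Set.rangeFactorization_surjective r
        refine connected_induce_of_reachable (subEdges_le (fun e => 0 < w e)) (a := a)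
          ⟨a.2, rfl⟩ ?_ ?_
        · rintro b ⟨hb, hab⟩
          exact ((hf _ _).1 hab).symm
        · rintro x ⟨hx, hxa⟩ y hxy
          have hy : y ∈ C := hx.trans (hxy.reachable.mono (subEdges_mono fun _ => le_of_lt))
          refine ⟨hy, (Eq.trans ?_ hxa)⟩
          exact (hf ⟨y, hy⟩ ⟨x, hx⟩).2 hxy.symm.reachable
      adj_iff := fun r r' => Iff.rfl }
  exact ⟨_, P, q, (mem_cell_iff hT q).2 ⟨fun β => Iff.rfl, hf⟩⟩

end Correspondence

end Arboreal

namespace Arboreal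

/-! ### The poset of correspondences above a given one -/

namespace Correspondence

variable {V W : Type u} {T : SimpleGraph V} {R : SimpleGraph W}

/-- The order allows another representative of the class of `p`; the isomorphism between the two is
absorbed into `q` through `ofIso`. -/
theorem toPoset_le_iff (p : Correspondence R T) {b : CorrPoset T} :
    p.toPoset ≤ b ↔
      ∃ (U : Type u) (P : SimpleGraph U) (q : Correspondence P R), b = (q.comp p).toPoset := by
  constructor
  · rintro ⟨U, W', P, R', p', q, h, rfl⟩
    obtain ⟨hS, e, he⟩ := toPoset_eq_iff.1 h
    refine ⟨U, P, q.comp (ofIso p.target_connected e),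
      toPoset_eq_iff.2 (Isomorphic.of_fibers ?_ ?_)⟩
    · ext v
      constructor
      · rintro ⟨h1, h2⟩
        have h3 : v ∈ p.S := hS ▸ h1
        refine ⟨h3, trivial, ?_⟩
        show e _ ∈ q.S
        rwa [he v h3 h1]
      · rintro ⟨h1, _, h2⟩
        have h3 : v ∈ p'.S := hS ▸ h1
        refine ⟨h3, ?_⟩
        rw [← he v h1 h3]
        exact h2
    · intro a b ha hb ha' hb'
      have key : ∀ (x : V) (hx : x ∈ (q.comp p').S)
          (hx' : x ∈ ((q.comp (ofIso p.target_connected e)).comp p).S),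
          (q.comp p').d ⟨x, hx⟩ = ((q.comp (ofIso p.target_connected e)).comp p).d ⟨x, hx'⟩ :=
        fun x hx hx' => congrArg q.d (Subtype.ext (he x hx'.1 hx.1).symm)
      rw [key a ha ha', key b hb hb']
  · rintro ⟨U, P, q, rfl⟩
    exact ⟨U, W, P, R, p, q, rfl, rfl⟩

/-- Since `p.d` is surjective, the vertex set and fibers of `q` can be tested on vertices of `p.S`.
-/
theorem comp_isomorphic_iff (p : Correspondence R T) {U U' : Type u} {P : SimpleGraph U}
    {P' : SimpleGraph U'} {q : Correspondence P R} {q' : Correspondence P' R} :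
    (q.comp p).Isomorphic (q'.comp p) ↔ q.Isomorphic q' := by
  constructor
  · intro h
    refine Isomorphic.of_fibers ?_ ?_
    · ext r
      obtain ⟨a, rfl⟩ := p.surjective r
      have := Set.ext_iff.1 h.1 a
      exact ⟨fun hr => (this.1 ⟨a.2, hr⟩).2, fun hr => (this.2 ⟨a.2, hr⟩).2⟩
    · intro r r' hr hr' hr2 hr2'
      obtain ⟨a, rfl⟩ := p.surjective r
      obtain ⟨b, rfl⟩ := p.surjective r'
      exact h.fibers a b ⟨a.2, hr⟩ ⟨b.2, hr'⟩ ⟨a.2, hr2⟩ ⟨b.2, hr2'⟩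
  · intro h
    refine Isomorphic.of_fibers ?_ ?_
    · ext v
      exact exists_congr fun _ => Set.ext_iff.1 h.1 _
    · intro a b ha hb ha' hb'
      exact h.fibers _ _ ha.2 hb.2 ha'.2 hb'.2

theorem comp_assoc_isomorphic {U U' : Type u} {P : SimpleGraph U} {P' : SimpleGraph U'}
    (s : Correspondence P' P) (q : Correspondence P R) (p : Correspondence R T) :
    (s.comp (q.comp p)).Isomorphic ((s.comp q).comp p) := by
  refine Isomorphic.of_fibers ?_ fun _ _ _ _ _ _ => Iff.rfl
  ext v
  exact ⟨fun ⟨⟨h1, h2⟩, h3⟩ => ⟨h1, h2, h3⟩, fun ⟨h1, h2, h3⟩ => ⟨⟨h1, h2⟩, h3⟩⟩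

theorem comp_le_comp_iff (p : Correspondence R T) {U U' : Type u} {P : SimpleGraph U}
    {P' : SimpleGraph U'} {q : Correspondence P R} {q' : Correspondence P' R} :
    (q.comp p).toPoset ≤ (q'.comp p).toPoset ↔ q.toPoset ≤ q'.toPoset := by
  rw [toPoset_le_iff, toPoset_le_iff]
  refine exists_congr fun _ => exists_congr fun _ => exists_congr fun s => ?_
  rw [toPoset_eq_iff.2 (comp_assoc_isomorphic s q p), toPoset_eq_iff, toPoset_eq_iff,
    comp_isomorphic_iff]

/-- The map `q ↦ q ∘ p` from the correspondences of `R` to those of `T`. -/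
def compPoset (p : Correspondence R T) (a : CorrPoset R) : CorrPoset T :=
  Quotient.lift (fun q : SomeCorrespondence R => (q.corr.comp p).toPoset)
    (fun _ _ h => toPoset_eq_iff.2 (p.comp_isomorphic_iff.2 h)) a

/-- The isomorphism `q ↦ q ∘ p` from the correspondences of `R` to those of `T` above `p`. -/
noncomputable def compOrderIso (p : Correspondence R T) :
    CorrPoset R ≃o Set.Ici p.toPoset :=
  RelIso.ofSurjective
    (OrderEmbedding.ofMapLEIff
      (fun a => (⟨p.compPoset a, by
        obtain ⟨q⟩ := a
        exact p.toPoset_le_iff.2 ⟨_, _, q.corr, rfl⟩⟩ : Set.Ici p.toPoset))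
      (by
        rintro ⟨q⟩ ⟨q'⟩
        exact p.comp_le_comp_iff))
    (by
      rintro ⟨b, hb⟩
      obtain ⟨U, P, q, rfl⟩ := p.toPoset_le_iff.1 hb
      exact ⟨q.toPoset, rfl⟩)

theorem coe_compOrderIso (p : Correspondence R T) {U : Type u} {P : SimpleGraph U}
    (q : Correspondence P R) :
    (p.compOrderIso q.toPoset : CorrPoset T) = (q.comp p).toPoset := rfl

theorem isomorphic_ofIso_comp (p : Correspondence R T) :
    p.Isomorphic ((ofIso p.target_connected SimpleGraph.Iso.refl).comp p) := by
  refine Isomorphic.of_fibers ?_ fun _ _ _ _ _ _ => Iff.rfl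
  ext v
  exact ⟨fun h => ⟨h, trivial⟩, fun h => h.1⟩

/-! ### Stars and cells -/

theorem mem_star_iff [Finite W] (p : Correspondence R T) (hT : T.IsTree) {β : V}
    {w : T.edgeSet → ℝ} :
    point hT (β, w) ∈ p.toPoset.star ↔ ∃ hβ : β ∈ p.S, p.InStar ⟨β, hβ⟩ w := by
  simp only [CorrPoset.star, Set.mem_iUnion, Set.mem_Ici, exists_prop]
  constructor
  · rintro ⟨b, hb, h⟩
    obtain ⟨U, P, q, rfl⟩ := p.toPoset_le_iff.1 hb
    exact inStar_of_mem_cell_comp hT q h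
  · rintro ⟨hβ, h⟩
    have hR := p.target_isTree hT
    obtain ⟨U, P, q, hq⟩ := exists_mem_cell hR (point hR (p.d ⟨β, hβ⟩, p.restrictWeights w))
    exact ⟨(q.comp p).toPoset, p.toPoset_le_iff.2 ⟨U, P, q, rfl⟩,
      (h.mem_cell_comp_iff hT hR q).2 hq⟩

/-- The edge coordinates of the points of the cell of `p`. -/
def cellWeights (p : Correspondence R T) : Set (T.edgeSet → ℝ) :=
  {x | p.restrictWeights x = 0 ∧ ∀ e, p.sgn e ≠ 0 → 0 < p.sgn e * x e}

/-- A single nonnegative component forces every weight to be nonnegative, each edge of a tree being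
a bridge; one-point fibers exclude positive weights. -/
theorem mem_cell_ofIso_iff (hT : T.IsTree) {β : V} {w : T.edgeSet → ℝ} :
    point hT (β, w) ∈ (ofIso hT.connected (SimpleGraph.Iso.refl (G := T))).cell ↔ w = 0 := by
  rw [mem_cell_iff]
  constructor
  · rintro ⟨h1, h2⟩
    have h1' : ∀ γ, (nonnegGraph T w).Reachable β γ := fun γ => (h1 γ).1 trivial
    funext e
    obtain ⟨e, he⟩ := e
    induction e with | _ a b =>
    have hab : T.Adj a b := he
    have h3 : 0 ≤ w ⟨s(a, b), he⟩ := of_reachable_of_adj hT.isAcyclic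
      (P := fun e => 0 ≤ w e) ((h1' a).symm.trans (h1' b)) hab
    refine le_antisymm (not_lt.1 fun h4 => hab.ne ?_) h3
    have hadj : (posGraph T w).Adj a b := ⟨hab, h4⟩
    exact (h2 ⟨a, trivial⟩ ⟨b, trivial⟩).2 hadj.reachable
  · rintro rfl
    refine ⟨fun γ => ⟨fun _ => ?_, fun _ => trivial⟩, ?_⟩
    · exact (hT.connected.preconnected β γ).mono fun x y h => ⟨h, le_rfl⟩
    · rintro ⟨a, ha⟩ ⟨b, hb⟩
      constructor
      · intro h
        obtain rfl : a = b := h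
        exact .refl _
      · intro h
        refine reachable_induction (motive := fun x => a = x) h rfl fun x y _ hxy _ => ?_
        exact absurd hxy.2 (lt_irrefl _)

theorem slack_zero [Finite W] (p : Correspondence R T) (hR : R.IsTree) (e : T.edgeSet) (r : W) :
    p.slack e (r, 0) = 0 := by
  by_cases he : p.sgn e = 0
  · exact p.slack_of_sgn_eq_zero he _
  · have : ∀ r', gap R r' (r, (0 : R.edgeSet → ℝ)) = 0 := fun r' => (gap_eq_zero_iff hR).2
      ((hR.connected.preconnected r r').mono fun x y h => ⟨h, le_rfl⟩)
    rcases p.sgn_cases he with ⟨x, y, h, hd, rfl⟩ | ⟨x, y, h, hy, rfl⟩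
    · rw [p.slack_inner h hd, this]
    · rw [p.slack_border h hy, this]

/-- Writing `p` as the identity correspondence composed with `p` describes its cell as the part of
the star over the origin of L_R, where every slack is 0 and only the sign conditions remain. -/
theorem mem_cell_iff_cellWeights [Finite W] (p : Correspondence R T) (hT : T.IsTree) {β : V}
    {w : T.edgeSet → ℝ} :
    point hT (β, w) ∈ p.toPoset.cell ↔ β ∈ p.S ∧ w ∈ p.cellWeights := by
  have hR := p.target_isTree hT
  rw [toPoset_eq_iff.2 p.isomorphic_ofIso_comp]
  show point hT (β, w) ∈ Correspondence.cell _ ↔ _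
  constructor
  · intro h
    obtain ⟨hβ, hs⟩ := inStar_of_mem_cell_comp hT _ h
    have h0 := (mem_cell_ofIso_iff hR).1 ((hs.mem_cell_comp_iff hT hR _).1 h)
    refine ⟨hβ, h0, fun e he => (hs e he).resolve_left ?_⟩
    rw [h0, p.slack_zero hR]
    exact lt_irrefl _
  · rintro ⟨hβ, h0, hs⟩
    have hst : p.InStar ⟨β, hβ⟩ w := fun e he => Or.inr (hs e he)
    rw [hst.mem_cell_comp_iff hT hR, mem_cell_ofIso_iff]
    exact h0

end Correspondence

end Arboreal

namespace Arboreal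

/-! ### The homeomorphism -/

/-- The radicand is (x + t/x)², and x + t/x has the sign σ. -/
theorem sqrt_shift {σ t x : ℝ} (hσ : σ * σ = 1) (ht : 0 ≤ t) (hx : 0 < σ * x) :
    ((x - t / x) + σ * √((x - t / x) ^ 2 + 4 * t)) / 2 = x := by
  have hx0 : x ≠ 0 := by rintro rfl; simp at hx
  have h1 : (x - t / x) ^ 2 + 4 * t = (σ * (x + t / x)) ^ 2 := by
    have : (σ * (x + t / x)) ^ 2 = (σ * σ) * (x + t / x) ^ 2 := by ring
    rw [this, hσ]
    field_simp
    ring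
  have h2 : 0 ≤ σ * (x + t / x) := by
    have : σ * (x + t / x) = σ * x + t * (σ * x) / x ^ 2 := by field_simp
    rw [this]
    positivity
  rw [h1, Real.sqrt_sq h2, ← mul_assoc, hσ]
  ring

theorem sqrt_shift_pos {σ t u : ℝ} (hσ : σ * σ = 1) (h : 0 < t ∨ 0 < σ * u) :
    0 < σ * ((u + σ * √(u ^ 2 + 4 * t)) / 2) := by
  have h1 : σ * ((u + σ * √(u ^ 2 + 4 * t)) / 2) = (σ * u + √(u ^ 2 + 4 * t)) / 2 := by
    have : σ * ((u + σ * √(u ^ 2 + 4 * t)) / 2) =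
      (σ * u + σ * σ * √(u ^ 2 + 4 * t)) / 2 := by ring
    rw [this, hσ, one_mul]
  rw [h1]
  rcases h with h | h
  · have h2 : |σ * u| < √(u ^ 2 + 4 * t) := by
      refine Real.lt_sqrt_of_sq_lt ?_
      have : |σ * u| ^ 2 = (σ * σ) * u ^ 2 := by rw [sq_abs]; ring
      rw [this, hσ]
      linarith
    have := neg_abs_le (σ * u)
    linarith
  · have := Real.sqrt_nonneg (u ^ 2 + 4 * t)
    linarith

/-- The number x = (u + σ√(u² + 4t))/2 is the root of sign σ of x² - ux - t = 0. -/
theorem shift_sqrt {σ t u : ℝ} (hσ : σ * σ = 1) (ht : 0 ≤ t) (h : 0 < t ∨ 0 < σ * u) :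
    (u + σ * √(u ^ 2 + 4 * t)) / 2 - t / ((u + σ * √(u ^ 2 + 4 * t)) / 2) = u := by
  have hpos := sqrt_shift_pos hσ h
  have hs : √(u ^ 2 + 4 * t) ^ 2 = u ^ 2 + 4 * t := Real.sq_sqrt (by positivity)
  set s := √(u ^ 2 + 4 * t)
  have hx0 : (u + σ * s) / 2 ≠ 0 := by intro h0; rw [h0, mul_zero] at hpos; exact lt_irrefl _ hpos
  have ht' : t = (u + σ * s) / 2 * ((u + σ * s) / 2 - u) := by
    have : (u + σ * s) / 2 * ((u + σ * s) / 2 - u) = ((σ * σ) * s ^ 2 - u ^ 2) / 4 := by ring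
    rw [this, hσ, hs]
    ring
  rw [div_eq_of_eq_mul hx0 (ht'.trans (mul_comm _ _))]
  ring

namespace Correspondence

variable {V W : Type u} {T : SimpleGraph V} {R : SimpleGraph W}

open Classical in
/-- The edge coordinates of the point of `L_T(≥ p)` given by a point of the cell of `p` with edge
coordinates `x` and the point `z` of `L_R`. -/
noncomputable def push (p : Correspondence R T) (x : T.edgeSet → ℝ) (z : W × (R.edgeSet → ℝ))
    (e : T.edgeSet) : ℝ :=
  if h : ∃ e', p.liftEdge e' = e then z.2 h.choose else x e - p.slack e z / x e

open Classical in
/-- The edge coordinates of the component in the cell of `p` of a point of `L_T(≥ p)`. -/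
noncomputable def pull (p : Correspondence R T) (r : W) (u : T.edgeSet → ℝ) (e : T.edgeSet) : ℝ :=
  if ∃ e', p.liftEdge e' = e then 0 else if p.sgn e = 0 then u e else
    (u e + p.sgn e * √(u e ^ 2 + 4 * p.slack e (r, p.restrictWeights u))) / 2

theorem push_liftEdge (p : Correspondence R T) (hT : T.IsAcyclic) (x : T.edgeSet → ℝ)
    (z : W × (R.edgeSet → ℝ)) (e : R.edgeSet) : p.push x z (p.liftEdge e) = z.2 e := by
  have hex : ∃ e', p.liftEdge e' = p.liftEdge e := ⟨e, rfl⟩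
  rw [push, dif_pos hex, p.liftEdge_injective hT hex.choose_spec]

theorem restrictWeights_push (p : Correspondence R T) (hT : T.IsAcyclic) (x : T.edgeSet → ℝ)
    (z : W × (R.edgeSet → ℝ)) : p.restrictWeights (p.push x z) = z.2 :=
  funext fun e => p.push_liftEdge hT x z e

theorem push_of_sgn_ne_zero (p : Correspondence R T) (hT : T.IsAcyclic) (x : T.edgeSet → ℝ)
    (z : W × (R.edgeSet → ℝ)) {e : T.edgeSet} (he : p.sgn e ≠ 0) :
    p.push x z e = x e - p.slack e z / x e :=
  dif_neg (by rintro ⟨e', rfl⟩; exact he (p.sgn_liftEdge hT e'))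

theorem pull_of_sgn_ne_zero (p : Correspondence R T) (hT : T.IsAcyclic) (r : W)
    (u : T.edgeSet → ℝ) {e : T.edgeSet} (he : p.sgn e ≠ 0) : p.pull r u e =
      (u e + p.sgn e * √(u e ^ 2 + 4 * p.slack e (r, p.restrictWeights u))) / 2 := by
  rw [pull, if_neg (by rintro ⟨e', rfl⟩; exact he (p.sgn_liftEdge hT e')), if_neg he]

theorem inStar_push (p : Correspondence R T) (hT : T.IsAcyclic) {x : T.edgeSet → ℝ}
    (hx : x ∈ p.cellWeights) (a : p.S) (v : R.edgeSet → ℝ) :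
    p.InStar a (p.push x (p.d a, v)) := by
  intro e he
  rw [p.restrictWeights_push hT, p.push_of_sgn_ne_zero hT _ _ he]
  rcases (p.slack_nonneg e (p.d a, v)).lt_or_eq with h | h
  · exact Or.inl h
  · right
    rw [← h, zero_div, sub_zero]
    exact hx.2 e he

theorem pull_mem_cellWeights (p : Correspondence R T) (hT : T.IsAcyclic) {a : p.S}
    {u : T.edgeSet → ℝ} (hu : p.InStar a u) : p.pull (p.d a) u ∈ p.cellWeights := by
  refine ⟨funext fun e => if_pos ⟨e, rfl⟩, fun e he => ?_⟩
  rw [p.pull_of_sgn_ne_zero hT _ _ he]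
  exact sqrt_shift_pos (p.sgn_mul_self he) (hu e he)

theorem pull_push (p : Correspondence R T) (hT : T.IsAcyclic) {x : T.edgeSet → ℝ}
    (hx : x ∈ p.cellWeights) (r : W) (v : R.edgeSet → ℝ) :
    p.pull r (p.push x (r, v)) = x := by
  funext e
  by_cases he : p.sgn e = 0
  · by_cases hex : ∃ e', p.liftEdge e' = e
    · obtain ⟨e', rfl⟩ := hex
      exact (if_pos ⟨e', rfl⟩).trans (congrFun hx.1 e').symm
    · rw [pull, if_neg hex, if_pos he, push, dif_neg hex, p.slack_of_sgn_eq_zero he, zero_div,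
        sub_zero]
  · rw [p.pull_of_sgn_ne_zero hT _ _ he, p.restrictWeights_push hT, p.push_of_sgn_ne_zero hT _ _ he]
    exact sqrt_shift (p.sgn_mul_self he) (p.slack_nonneg _ _) (hx.2 e he)

theorem push_pull (p : Correspondence R T) (hT : T.IsAcyclic) {a : p.S}
    {u : T.edgeSet → ℝ} (hu : p.InStar a u) :
    p.push (p.pull (p.d a) u) (p.d a, p.restrictWeights u) = u := by
  funext e
  by_cases he : p.sgn e = 0
  · by_cases hex : ∃ e', p.liftEdge e' = e
    · obtain ⟨e', rfl⟩ := hex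
      rw [p.push_liftEdge hT]
      rfl
    · rw [push, dif_neg hex, p.slack_of_sgn_eq_zero he, zero_div, sub_zero, pull, if_neg hex,
        if_pos he]
  · rw [p.push_of_sgn_ne_zero hT _ _ he, p.pull_of_sgn_ne_zero hT _ _ he]
    exact shift_sqrt (p.sgn_mul_self he) (p.slack_nonneg _ _) (hu e he)

/-- The gap is constant along gluings, so `push` depends only on the point of L_R and not on its
chart. -/
theorem push_eq_of_reachable (p : Correspondence R T) (x : T.edgeSet → ℝ) {q q' : W}
    {v : R.edgeSet → ℝ} (h : (nonnegGraph R v).Reachable q q') :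
    p.push x (q, v) = p.push x (q', v) := by
  funext e
  rw [push, push, p.slack_eq_of_reachable e h]

theorem pull_eq_of_reachable (p : Correspondence R T) (u : T.edgeSet → ℝ) {q q' : W}
    (h : (nonnegGraph R (p.restrictWeights u)).Reachable q q') : p.pull q u = p.pull q' u := by
  funext e
  rw [pull, pull, p.slack_eq_of_reachable e h]

theorem push_zero [Finite W] (p : Correspondence R T) (hT : T.IsTree) {x : T.edgeSet → ℝ}
    (hx : x ∈ p.cellWeights) (r : W) : p.push x (r, 0) = x := by
  funext e
  by_cases hex : ∃ e', p.liftEdge e' = e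
  · obtain ⟨e', rfl⟩ := hex
    rw [p.push_liftEdge hT.isAcyclic]
    exact (congrFun hx.1 e').symm
  · rw [push, dif_neg hex, p.slack_zero (p.target_isTree hT), zero_div, sub_zero]

theorem continuous_push [Finite W] [TopologicalSpace W] [DiscreteTopology W]
    (p : Correspondence R T) :
    Continuous fun y : p.cellWeights × (W × (R.edgeSet → ℝ)) => p.push y.1 y.2 := by
  refine continuous_pi fun e => ?_
  unfold push
  have hx : Continuous fun y : p.cellWeights × (W × (R.edgeSet → ℝ)) => y.1.1 e :=
    (continuous_apply e).comp (continuous_subtype_val.comp continuous_fst)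
  split_ifs with hex
  · fun_prop
  · by_cases he : p.sgn e = 0
    -- Here x e may vanish, but the numerator is identically 0.
    · simpa only [p.slack_of_sgn_eq_zero he, zero_div, sub_zero] using hx
    · refine hx.sub (((p.continuous_slack e).comp continuous_snd).div₀ hx fun y h0 => ?_)
      have := y.1.2.2 e he
      rw [h0, mul_zero] at this
      exact lt_irrefl _ this

theorem continuous_pull [Finite W] [TopologicalSpace W] [DiscreteTopology W]
    (p : Correspondence R T) :
    Continuous fun y : W × (T.edgeSet → ℝ) => p.pull y.1 y.2 := by
  refine continuous_pi fun e => ?_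
  unfold pull
  have hs : Continuous fun y : W × (T.edgeSet → ℝ) => p.slack e (y.1, p.restrictWeights y.2) :=
    (p.continuous_slack e).comp (continuous_fst.prodMk
      (continuous_pi fun e' => (continuous_apply (p.liftEdge e')).comp continuous_snd))
  split_ifs <;> fun_prop

/-! ### The two inverse maps between the product and the star. -/

/-- The point of `L_T` given by a point of the cell of `p` and a point of `L_R`. -/
noncomputable def expand (p : Correspondence R T) (hT : T.IsTree)
    (y : p.cellWeights × Singularity R) : Singularity T :=
  let z := Function.surjInv (point_surjective (p.target_isTree hT)) y.2
  point hT ((Function.surjInv p.surjective z.1).1, p.push y.1 z)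

/-- The choices in `expand` are harmless: another chart of the same point of L_R gives the same
weights, and any vertex of `p.S` over the same nonnegative component of `R` lies in the same
nonnegative component of `T`. -/
theorem expand_point [Finite W] (p : Correspondence R T) (hT : T.IsTree) (hR : R.IsTree)
    (x : p.cellWeights) (a : p.S) (v : R.edgeSet → ℝ) :
    p.expand hT (x, point hR (p.d a, v)) = point hT (a.1, p.push x (p.d a, v)) := by
  have hz := Function.surjInv_eq (point_surjective (p.target_isTree hT)) (point hR (p.d a, v))
  rw [expand]
  generalize Function.surjInv (point_surjective (p.target_isTree hT))
    (point hR (p.d a, v)) = z at hz ⊢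
  obtain ⟨q, v'⟩ := z
  obtain ⟨rfl, hr⟩ := (point_eq_iff hR).1 hz
  obtain ⟨b, rfl, hb⟩ : ∃ b : p.S, p.d b = q ∧ Function.surjInv p.surjective q = b :=
    ⟨_, Function.surjInv_eq p.surjective q, rfl⟩
  simp only [hb, p.push_eq_of_reachable x.1 hr]
  rw [eq_comm, point_eq_iff]
  refine ⟨rfl, ((p.inStar_push hT.isAcyclic x.2 a v').nonneg_reachable_iff hT).2 ⟨b.2, ?_⟩⟩
  rw [p.restrictWeights_push hT.isAcyclic]
  exact hr.symm

theorem expand_mem_star [Finite W] (p : Correspondence R T) (hT : T.IsTree)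
    (y : p.cellWeights × Singularity R) : p.expand hT y ∈ p.toPoset.star := by
  obtain ⟨x, y⟩ := y
  have hR := p.target_isTree hT
  obtain ⟨⟨r, v⟩, rfl⟩ := point_surjective hR y
  obtain ⟨a, rfl⟩ := p.surjective r
  rw [p.expand_point hT, p.mem_star_iff hT]
  exact ⟨a.2, p.inStar_push hT.isAcyclic x.2 a v⟩

theorem continuous_expand [Finite V] [Finite W] (p : Correspondence R T) (hT : T.IsTree) :
    Continuous (p.expand hT) := by
  have hR := p.target_isTree hT
  let _ : TopologicalSpace V := ⊥
  have : DiscreteTopology V := ⟨rfl⟩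
  let _ : TopologicalSpace W := ⊥
  have : DiscreteTopology W := ⟨rfl⟩
  -- A product of quotient maps need not be a quotient map; properness makes this one closed, hence
  -- a quotient map.
  have hp : IsProperMap (Prod.map (id : p.cellWeights → p.cellWeights) (point hR)) :=
    isProperMap_id.prodMap (isProperMap_point hR)
  have hq := hp.isClosedMap.isQuotientMap hp.continuous
    (Function.surjective_id.prodMap (point_surjective hR))
  rw [hq.continuous_iff]
  have hs : Continuous fun r : W => (Function.surjInv p.surjective r).1 :=
    continuous_of_discreteTopology
  refine ((isProperMap_point hT).continuous.comp ((hs.comp (continuous_fst.comp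
    continuous_snd)).prodMk p.continuous_push)).congr fun y => ?_
  obtain ⟨x, r, v⟩ := y
  have h := p.expand_point hT hR x (Function.surjInv p.surjective r) v
  rw [Function.surjInv_eq p.surjective r] at h
  exact h.symm

/-- A representative in edge coordinates of a point of the star of `p`. -/
theorem exists_rep [Finite W] (p : Correspondence R T) (hT : T.IsTree) (x : p.toPoset.star) :
    ∃ z : p.S × (T.edgeSet → ℝ), point hT (z.1.1, z.2) = x ∧ p.InStar z.1 z.2 := by
  obtain ⟨x, hx⟩ := x
  obtain ⟨⟨β, w⟩, rfl⟩ := point_surjective hT x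
  obtain ⟨hβ, h⟩ := (p.mem_star_iff hT).1 hx
  exact ⟨⟨⟨β, hβ⟩, w⟩, rfl, h⟩

/-- The components in the cell of `p` and in `L_R` of a point of `L_T(≥ p)`. -/
noncomputable def contract [Finite W] (p : Correspondence R T) (hT : T.IsTree)
    (x : p.toPoset.star) : p.cellWeights × Singularity R :=
  let z := (p.exists_rep hT x).choose
  (⟨p.pull (p.d z.1) z.2,
    p.pull_mem_cellWeights hT.isAcyclic (p.exists_rep hT x).choose_spec.2⟩,
    point (p.target_isTree hT) (p.d z.1, p.restrictWeights z.2))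

/-- Two representatives differ by a path of nonnegative edges in `T`; it projects to such a path in
`R`, which changes neither `pull` nor the point of L_R. -/
theorem contract_point [Finite W] (p : Correspondence R T) (hT : T.IsTree) (hR : R.IsTree)
    {a : p.S} {u : T.edgeSet → ℝ} (hu : p.InStar a u) (h : point hT (a.1, u) ∈ p.toPoset.star) :
    p.contract hT ⟨_, h⟩ = (⟨p.pull (p.d a) u, p.pull_mem_cellWeights hT.isAcyclic hu⟩,
      point hR (p.d a, p.restrictWeights u)) := by
  have hz := (p.exists_rep hT ⟨_, h⟩).choose_spec
  set z := (p.exists_rep hT ⟨_, h⟩).choose with hzdef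
  obtain ⟨h1, h2⟩ := (point_eq_iff hT).1 hz.1.symm
  have h3 := ((hu.nonneg_reachable_iff hT).1 h2).2
  refine Prod.ext (Subtype.ext ?_) ?_
  · show p.pull (p.d z.1) z.2 = _
    rw [← h1]
    exact (p.pull_eq_of_reachable u h3).symm
  · show point hR (p.d z.1, p.restrictWeights z.2) = _
    rw [← h1]
    exact ((point_eq_iff hR).2 ⟨rfl, h3⟩).symm

theorem continuous_contract [Finite V] [Finite W] (p : Correspondence R T) (hT : T.IsTree) :
    Continuous (p.contract hT) := by
  have hR := p.target_isTree hT
  let _ : TopologicalSpace V := ⊥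
  have : DiscreteTopology V := ⟨rfl⟩
  let _ : TopologicalSpace W := ⊥
  have : DiscreteTopology W := ⟨rfl⟩
  have hp : IsProperMap (p.toPoset.star.restrictPreimage (point hT)) :=
    (isProperMap_point hT).restrictPreimage _
  have hq := hp.isClosedMap.isQuotientMap hp.continuous
    (Set.restrictPreimage_surjective _ (point_surjective hT))
  rw [hq.continuous_iff]
  have hmem : ∀ z : point hT ⁻¹' p.toPoset.star,
      ∃ hβ : z.1.1 ∈ p.S, p.InStar ⟨z.1.1, hβ⟩ z.1.2 := fun z => (p.mem_star_iff hT).1 z.2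
  have hd : Continuous fun z : point hT ⁻¹' p.toPoset.star => p.d ⟨z.1.1, (hmem z).1⟩ :=
    (continuous_of_discreteTopology (f := p.d)).comp
      ((continuous_fst.comp continuous_subtype_val).subtype_mk _)
  have hu : Continuous fun z : point hT ⁻¹' p.toPoset.star => z.1.2 :=
    continuous_snd.comp continuous_subtype_val
  have hv : Continuous fun z : point hT ⁻¹' p.toPoset.star => p.restrictWeights z.1.2 :=
    continuous_pi fun e' => (continuous_apply (p.liftEdge e')).comp hu
  have h1 : Continuous fun z : point hT ⁻¹' p.toPoset.star =>
      (⟨p.pull (p.d ⟨z.1.1, (hmem z).1⟩) z.1.2,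
        p.pull_mem_cellWeights hT.isAcyclic (hmem z).2⟩ : p.cellWeights) :=
    (p.continuous_pull.comp (hd.prodMk hu)).subtype_mk _
  have h2 : Continuous fun z : point hT ⁻¹' p.toPoset.star =>
      point hR (p.d ⟨z.1.1, (hmem z).1⟩, p.restrictWeights z.1.2) :=
    (isProperMap_point hR).continuous.comp (hd.prodMk hv)
  exact (h1.prodMk h2).congr fun z => (p.contract_point hT hR (hmem z).2 z.2).symm

/-- The product decomposition of the star of `p`, in edge coordinates. -/
noncomputable def starHomeo [Finite V] [Finite W] (p : Correspondence R T) (hT : T.IsTree) :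
    p.cellWeights × Singularity R ≃ₜ p.toPoset.star where
  toFun y := ⟨p.expand hT y, p.expand_mem_star hT y⟩
  invFun := p.contract hT
  left_inv := by
    rintro ⟨x, y⟩
    have hR := p.target_isTree hT
    obtain ⟨⟨r, v⟩, rfl⟩ := point_surjective hR y
    obtain ⟨a, rfl⟩ := p.surjective r
    have hst := p.inStar_push hT.isAcyclic x.2 a v
    simp only [p.expand_point hT hR x a v]
    rw [p.contract_point hT hR hst]
    refine Prod.ext (Subtype.ext (p.pull_push hT.isAcyclic x.2 _ v)) ?_
    simp only [p.restrictWeights_push hT.isAcyclic]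
  right_inv := by
    rintro ⟨y, hy⟩
    have hR := p.target_isTree hT
    obtain ⟨⟨β, w⟩, rfl⟩ := point_surjective hT y
    obtain ⟨hβ, hu⟩ := (p.mem_star_iff hT).1 hy
    refine Subtype.ext ?_
    show p.expand hT (p.contract hT ⟨_, hy⟩) = _
    rw [p.contract_point hT hR (a := ⟨β, hβ⟩) hu, p.expand_point hT hR,
      p.push_pull hT.isAcyclic hu]
  continuous_toFun := (p.continuous_expand hT).subtype_mk _
  continuous_invFun := p.continuous_contract hT

/-! ### The cell in edge coordinates, and openness of the star. -/

theorem weights_mem_cellWeights [Finite W] (p : Correspondence R T) (hT : T.IsTree)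
    {x : Singularity T} (hx : x ∈ p.toPoset.cell) : weights hT x ∈ p.cellWeights := by
  obtain ⟨⟨β, w⟩, rfl⟩ := point_surjective hT x
  rw [weights_point]
  exact ((p.mem_cell_iff_cellWeights hT).1 hx).2

/-- The cell of `p` in edge coordinates. -/
noncomputable def cellHomeo [Finite V] [Finite W] (p : Correspondence R T) (hT : T.IsTree) :
    p.toPoset.cell ≃ₜ p.cellWeights where
  toFun x := ⟨weights hT x, p.weights_mem_cellWeights hT x.2⟩
  invFun w := ⟨point hT (p.connected.nonempty.some.1, w),
    (p.mem_cell_iff_cellWeights hT).2 ⟨p.connected.nonempty.some.2, w.2⟩⟩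
  left_inv := by
    rintro ⟨x, hx⟩
    obtain ⟨⟨β, w⟩, rfl⟩ := point_surjective hT x
    refine Subtype.ext ?_
    show point hT (_, weights hT (point hT (β, w))) = point hT (β, w)
    rw [weights_point, eq_comm, point_eq_iff]
    exact ⟨rfl, (((mem_cell_iff hT p).1 hx).1 _).1 p.connected.nonempty.some.2⟩
  right_inv w := Subtype.ext (weights_point hT _)
  continuous_toFun := ((continuous_weights hT).comp continuous_subtype_val).subtype_mk _
  continuous_invFun := by
    let _ : TopologicalSpace V := ⊥
    have : DiscreteTopology V := ⟨rfl⟩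
    exact ((isProperMap_point hT).continuous.comp
      (continuous_const.prodMk continuous_subtype_val)).subtype_mk _

/-- In each chart the star is empty or given by finitely many conditions, each a union of two strict
inequalities between continuous functions. -/
theorem isOpen_star [Finite V] [Finite W] (p : Correspondence R T) (hT : T.IsTree) :
    IsOpen p.toPoset.star := by
  let _ : TopologicalSpace V := ⊥
  have : DiscreteTopology V := ⟨rfl⟩
  let _ : TopologicalSpace W := ⊥
  have : DiscreteTopology W := ⟨rfl⟩
  rw [← (isQuotientMap_point hT).isOpen_preimage, isOpen_iff_continuous_mem,
    continuous_prod_of_discrete_left]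
  refine fun β => isOpen_iff_continuous_mem.1
    (?_ : IsOpen {w | point hT (β, w) ∈ p.toPoset.star})
  simp only [p.mem_star_iff hT, InStar]
  by_cases hβ : β ∈ p.S
  · simp only [hβ, exists_true_left, Set.ofPred_forall]
    refine isOpen_iInter_of_finite fun e => isOpen_iInter_of_finite fun he => ?_
    have hv : Continuous fun w : T.edgeSet → ℝ => (p.d ⟨β, hβ⟩, p.restrictWeights w) :=
      continuous_const.prodMk (continuous_pi fun e' => continuous_apply (p.liftEdge e'))
    exact (isOpen_lt continuous_const ((p.continuous_slack e).comp hv)).union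
      (isOpen_lt continuous_const (continuous_const.mul (continuous_apply e)))
  · simp [hβ]

end Correspondence

end Arboreal

/-! ### The product decomposition of the star. -/

theorem mainTheorem10 {V W : Type u} [Finite V] (T : SimpleGraph V) (hT : T.IsTree)
    (R : SimpleGraph W) (p : Arboreal.Correspondence R T) :
    IsOpen p.toPoset.star ∧
    ∃ Φ : Arboreal.CorrPoset R ≃o Set.Ici p.toPoset,
      (∀ (U : Type u) (P : SimpleGraph U) (q : Arboreal.Correspondence P R),
        (Φ q.toPoset : Arboreal.CorrPoset T) = (q.comp p).toPoset) ∧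
      ∃ Ψ : p.toPoset.cell × Arboreal.Singularity R ≃ₜ p.toPoset.star,
        (∀ (x : p.toPoset.cell) (y : Arboreal.Singularity R) (a : Arboreal.CorrPoset R),
          (Ψ (x, y) : Arboreal.Singularity T) ∈ (Φ a : Arboreal.CorrPoset T).cell ↔
            y ∈ a.cell) ∧
        (∀ (x : p.toPoset.cell) (r : W),
          (Ψ (x, Arboreal.chart R r 0) : Arboreal.Singularity T) = x) := by
  have : Finite W := Finite.of_surjective p.d p.surjective
  have hR := p.target_isTree hT
  refine ⟨p.isOpen_star hT, p.compOrderIso, fun U P q => p.coe_compOrderIso q,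
    ((p.cellHomeo hT).prodCongr (Homeomorph.refl _)).trans (p.starHomeo hT), ?_, ?_⟩
  · rintro x y ⟨q⟩
    obtain ⟨⟨r, v⟩, rfl⟩ := Arboreal.point_surjective hR y
    obtain ⟨a, rfl⟩ := p.surjective r
    show p.expand hT (p.cellHomeo hT x, Arboreal.point hR (p.d a, v)) ∈ (q.corr.comp p).cell ↔
      Arboreal.point hR (p.d a, v) ∈ q.corr.cell
    rw [p.expand_point hT hR,
      (p.inStar_push hT.isAcyclic (p.cellHomeo hT x).2 a v).mem_cell_comp_iff hT hR,
      p.restrictWeights_push hT.isAcyclic]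
  · intro x r
    obtain ⟨a, rfl⟩ := p.surjective r
    show p.expand hT (p.cellHomeo hT x, Arboreal.chart R (p.d a) 0) = x
    rw [Arboreal.chart_zero hR, p.expand_point hT hR, p.push_zero hT (p.cellHomeo hT x).2]
    obtain ⟨x, hx⟩ := x
    obtain ⟨⟨β, w⟩, rfl⟩ := Arboreal.point_surjective hT x
    show Arboreal.point hT (a.1, Arboreal.weights hT (Arboreal.point hT (β, w))) = _
    rw [Arboreal.weights_point, eq_comm, Arboreal.point_eq_iff]
    -- The vertices `a` and `β` may differ, but on the cell all of `p.S` is one nonnegative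
    -- component, so both charts give the same point.
    exact ⟨rfl, (((Arboreal.mem_cell_iff hT p).1 hx).1 _).1 a.2⟩
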